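/- **Setting.** A grid diagram $\mathbb G$ with grid number $n\ge 1$ is an $n\times n$ grid in whose squares $X$'s and $O$'s are placed so that each row and each column contains exactly one $X$ and one $O$ and no square contains both. Gluing opposite sides gives the toroidal diagram; cyclic permutations of rows and columns give its other planar realizations. To a column assign the closed interval between the heights of its two markings. A *column commutation* interchanges two consecutive columns whose intervals are disjoint or such that one contains the other; a *row commutation* is the same with rows in place of columns. Two (toroidal) diagrams *differ by a commutation move* if they have planar realizations that differ by a column or a row commutation. Let $t\in[0,2]$ and let $\mathcal R_t$ be the subring generated by $U^t$ and $U^{2-t}$ of the ring of long power series $\sum_{\alpha\in A}U^\alpha$ ($A\subset\mathbb R_{\ge0}$ well-ordered) over $\mathbb F_2$. A grid state is a set of $n$ points of the torus with exactly one on each horizontal and each vertical circle; $\mathbf S(\mathbb G)$ is the set of grid states. $tGC^-(\mathbb G)$ is the free $\mathcal R_t$-module on $\mathbf S(\mathbb G)$ with $$\partial_t^-(\mathbf x)=\sum_{\mathbf y}\sum_{r}U^{t|\mathbb X\cap r|+(2-t)|\mathbb O\cap r|}\,\mathbf y ,$$ where $r$ runs over the empty rectangles from $\mathbf x$ to $\mathbf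 y$. With points of a state at integer coordinates, markings at the centres of their squares in a planar realization, and $J(P,Q)$ equal to half the number of pairs $(p,q)\in P\times Q$ such that one of $p,q$ is strictly northeast of the other, put $M_{\mathbb S}(\mathbf x)=J(\mathbf x,\mathbf x)-2J(\mathbf x,\mathbb S)+J(\mathbb S,\mathbb S)+1$, $M=M_{\mathbb O}$ and $A=\tfrac12(M_{\mathbb O}-M_{\mathbb X})-\tfrac{n-1}2$. The monomial $U^\alpha\mathbf x$ has degree $\mathrm{gr}_t(U^\alpha\mathbf x)=M(\mathbf x)-tA(\mathbf x)-\alpha$; $tGC^-_d(\mathbb G)$ is the $\mathbb F_2$-span of the monomials of degree $d$ in $tGC^-(\mathbb G)$. $tGH^-(\mathbb G)$ is the homology of $(tGC^-(\mathbb G),\partial_t^-)$, graded by the subgroups $tGH^-_d(\mathbb G)$ of the classes of cycles in $tGC^-_d(\mathbb G)$. **Theorem.** (1) If $\mathbb G$ and $\mathbb G'$ differ by a commutation move, then $tGH^-(\mathbb G)\cong tGH^-(\mathbb G')$ as graded $\mathcal R_t$-modules. (2) Let $\mathbb G'$ be obtained from $\mathbb G$ by a column commutation. Then both diagrams can be drawn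 on one torus with the same markings and the same circles, except that the vertical circle $\beta$ of $\mathbb G$ between the two columns is replaced for $\mathbb G'$ by a circle $\gamma$ that is disjoint from the other vertical circles, crosses each horizontal circle once and meets $\beta$ transversely in exactly two points $a,b$, not on horizontal circles, such that of the two bigons between $\beta$ and $\gamma$ the one with $\beta$ to the west and $\gamma$ to the east has southern vertex $a$ and northern vertex $b$ and contains exactly the two markings of the eastern column, and the other contains exactly the two markings of the western column. For every such drawing let $P:tGC^-(\mathbb G)\to tGC^-(\mathbb G')$ and $P':tGC^-(\mathbb G')\to tGC^-(\mathbb G)$ be the $\mathcal R_t$-linear maps that count empty pentagons $p$ between states of the two diagrams (convex-cornered embedded disks with five sides on the circles, four corners in the two states, the fifth at $a$ for $P$ and at $b$ for $P'$, whose horizontal sides point from the initial to the final state, and with no point of either state in the interior) with weight $U^{t|\mathbb X\cap p|+(2-t)|\mathbb O\cap p|}$; let $H$ on $tGC^-(\mathbb G)$ and $H'$ on $tGC^-(\mathbb G')$ count in the same way empty hexagons (with the two further corners at $a$ and $b$) between states of the same diagram. Then $P$ and $P'$ are chain maps preserving the grading, $H$ and $H'$ raise it by $1$, $$\partial_t^-H+H\partial_t^-=\mathrm{Id}-P'P,\qquad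 \partial_t^-H'+H'\partial_t^-=\mathrm{Id}-PP',$$ and $P$ and $P'$ induce mutually inverse isomorphisms of graded $\mathcal R_t$-modules between $tGH^-(\mathbb G)$ and $tGH^-(\mathbb G')$. -/

import Mathlib

open scoped NNReal

noncomputable section

namespace GridHomology

/-! ### Grid diagrams and commutation moves -/

/-- A grid diagram with grid number `n`, given by a planar realization: columns and rows are
numbered by `Fin n` (from the west, from the south), and column `c` has its `X`-marking in row
`X c` and its `O`-marking in row `O c`. -/
structure GridDiagram (n : ℕ) where
  X : Equiv.Perm (Fin n)
  O : Equiv.Perm (Fin n)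
  ne : ∀ c, X c ≠ O c

variable {n : ℕ}

namespace GridDiagram

/-- Reflection in the diagonal; it exchanges the roles of rows and columns. -/
def transpose (G : GridDiagram n) : GridDiagram n where
  X := G.X.symm
  O := G.O.symm
  ne r h := G.ne (G.X.symm r) (by rw [Equiv.apply_symm_apply, h, Equiv.apply_symm_apply])

/-- Cyclic permutation of the columns by `p` and of the rows by `q`: another planar realization
of the same toroidal grid diagram. -/
def rotate [NeZero n] (G : GridDiagram n) (p q : Fin n) : GridDiagram n where
  X := (Equiv.addRight p).trans (G.X.trans (Equiv.addRight q))
  O := (Equiv.addRight p).trans (G.O.trans (Equiv.addRight q))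
  ne c h := G.ne (c + p) (by simpa using h)

/-- Interchange the columns `i` and `j`. -/
def swapColumns (G : GridDiagram n) (i j : Fin n) : GridDiagram n where
  X := G.X * Equiv.swap i j
  O := G.O * Equiv.swap i j
  ne c h := G.ne (Equiv.swap i j c) h

/-- The closed interval of heights between the two markings of column `c`. -/
def columnInterval (G : GridDiagram n) (c : Fin n) : Set (Fin n) :=
  Set.uIcc (G.O c) (G.X c)

end GridDiagram

/-- `G'` is obtained from `G` by interchanging the consecutive columns `i` and `i + 1` (with no
wrap-around), whose intervals are disjoint or nested. -/
def IsColumnCommutationAt [NeZero n] (G G' : GridDiagram n) (i : Fin n) : Prop :=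
  i.val + 1 < n ∧
  (Disjoint (G.columnInterval i) (G.columnInterval (i + 1)) ∨
    G.columnInterval i ⊆ G.columnInterval (i + 1) ∨
    G.columnInterval (i + 1) ⊆ G.columnInterval i) ∧
  G' = G.swapColumns i (i + 1)

/-- The planar diagrams differ by a column commutation or by a row commutation. -/
def IsPlanarCommutation [NeZero n] (G G' : GridDiagram n) : Prop :=
  (∃ i, IsColumnCommutationAt G G' i) ∨ (∃ i, IsColumnCommutationAt G.transpose G'.transpose i)

/-- The toroidal diagrams of `G` and `G'` differ by a commutation move: they have planar
realizations that do. -/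
def DifferByCommutation [NeZero n] (G G' : GridDiagram n) : Prop :=
  ∃ p q p' q' : Fin n, IsPlanarCommutation (G.rotate p q) (G'.rotate p' q')

/-! ### The coefficient ring -/

/-- The ring of long power series over `𝔽₂`: sums of powers `U ^ α` over a well-ordered set of
exponents `α ≥ 0`. -/
def LongPowerSeries : Type := HahnSeries ℝ≥0 (ZMod 2)

instance : CommRing LongPowerSeries := inferInstanceAs (CommRing (HahnSeries ℝ≥0 (ZMod 2)))

/-- The power `U ^ α`. -/
def U (α : ℝ≥0) : LongPowerSeries := (HahnSeries.single α 1 : HahnSeries ℝ≥0 (ZMod 2))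

/-- The subring generated by `U ^ t` and `U ^ (2 - t)` (used for `t ≤ 2` only, so that `2 - t` is
the true difference). -/
def subringRt (t : ℝ≥0) : Subring LongPowerSeries := Subring.closure {U t, U (2 - t)}

/-- The ring of elements of `subringRt t`. -/
def Rt (t : ℝ≥0) : Type := subringRt t

instance (t : ℝ≥0) : CommRing (Rt t) := inferInstanceAs (CommRing (subringRt t))

/-- A power of `U` as an element of `Rt t`. -/
def monomial (t α : ℝ≥0) (h : U α ∈ subringRt t) : Rt t := (⟨U α, h⟩ : subringRt t)

lemma U_mul (α β : ℝ≥0) : U α * U β = U (α + β) :=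
  (HahnSeries.single_mul_single (R := ZMod 2)).trans (by rw [mul_one]; rfl)

lemma U_pow (α : ℝ≥0) (k : ℕ) : U α ^ k = U (k * α) :=
  (HahnSeries.single_pow (R := ZMod 2) α k 1).trans (by rw [one_pow, nsmul_eq_mul]; rfl)

lemma U_mem (t : ℝ≥0) (a b : ℕ) : U (a * t + b * (2 - t)) ∈ subringRt t := by
  rw [← U_mul, ← U_pow, ← U_pow]
  exact mul_mem (pow_mem (Subring.subset_closure (by simp)) _)
    (pow_mem (Subring.subset_closure (by simp)) _)

/-- The coefficient `U ^ (t * a + (2 - t) * b)` of a region containing `a` markings `X` and `b`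
markings `O`. -/
def weight (t : ℝ≥0) (a b : ℕ) : Rt t := monomial t (a * t + b * (2 - t)) (U_mem t a b)

/-! ### Grid states and gradings -/

/-- A grid state: the horizontal and vertical circles of the torus are numbered by `Fin n`,
square `(c, r)` having vertical circle `c` on its west side and horizontal circle `r` on its
south side; the state `x` consists of the points where vertical circle `c` meets horizontal
circle `x c`. -/
abbrev GridState (n : ℕ) : Type := Equiv.Perm (Fin n)

/-- Points of a grid state in the plane. -/
def statePoint (x : GridState n) (c : Fin n) : ℚ × ℚ := ((c.val : ℚ), ((x c).val : ℚ))

/-- Markings sit in the centres of their squares. -/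
def markPoint (S : Equiv.Perm (Fin n)) (c : Fin n) : ℚ × ℚ :=
  ((c.val : ℚ) + 1 / 2, ((S c).val : ℚ) + 1 / 2)

/-- The number of pairs of a point of `p` and a point of `q` to the northeast of it. -/
def pairCount (p q : Fin n → ℚ × ℚ) : ℕ :=
  (Finset.univ.filter fun a : Fin n × Fin n =>
    (p a.1).1 < (q a.2).1 ∧ (p a.1).2 < (q a.2).2).card

/-- The symmetrization of `pairCount`. -/
def symCount (p q : Fin n → ℚ × ℚ) : ℝ := ((pairCount p q : ℝ) + (pairCount q p : ℝ)) / 2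

/-- The Maslov function with respect to a set `S` of markings:
`J(x - S, x - S) + 1`, expanded bilinearly. -/
def maslovOf (S : Equiv.Perm (Fin n)) (x : GridState n) : ℝ :=
  symCount (statePoint x) (statePoint x) - 2 * symCount (statePoint x) (markPoint S)
    + symCount (markPoint S) (markPoint S) + 1

/-- The Maslov grading. -/
def maslov (G : GridDiagram n) (x : GridState n) : ℝ := maslovOf G.O x

/-- The Alexander grading. -/
def alexander (G : GridDiagram n) (x : GridState n) : ℝ :=
  (maslovOf G.O x - maslovOf G.X x) / 2 - ((n : ℝ) - 1) / 2

/-- The `t`-grading of `U ^ α · x`. -/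
def gr (t : ℝ≥0) (G : GridDiagram n) (α : ℝ≥0) (x : GridState n) : ℝ :=
  maslov G x - t * alexander G x - α

/-! ### The `t`-modified grid complex -/

/-- `r` is met on the way up (east) from `s` to `t`, with `s` included and `t` excluded.  For rows
this says that row `r` lies between the horizontal circles `s` and `t`; for columns likewise. -/
def CycIco (s t r : Fin n) : Prop := (r - s).val < (t - s).val

/-- `r` is met strictly between `s` and `t`. -/
def CycIoo (s t r : Fin n) : Prop := r ≠ s ∧ (r - s).val < (t - s).val

/-- `r` is met from `s` to `t`, both included. -/
def CycIcc (s t r : Fin n) : Prop := (r - s).val ≤ (t - s).val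

/-- The underlying module of the complex: free over `Rt t` on the (finitely many) grid states, the
generator `x` being `Pi.single x 1`. -/
abbrev tGC (t : ℝ≥0) (_G : GridDiagram n) : Type := GridState n → Rt t

open Classical in
/-- Rectangles from `x` to `y`, encoded by the pair `(l, r)` of the vertical circles carrying
the west and the east side.  The corners of the rectangle are then `(l, x l)` in the southwest and
`(r, x r)` in the northeast, which belong to `x`, and `(r, x l)` and `(l, x r)`, which belong to
`y`.  So the horizontal sides point, in the boundary orientation, from `x` to `y`. -/
def rect (x y : GridState n) : Finset (Fin n × Fin n) :=
  Finset.univ.filter fun p => p.1 ≠ p.2 ∧ y = x * Equiv.swap p.1 p.2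

/-- No point of `x` on a vertical circle strictly between `l` and `r` lies at a height strictly
between `x l` and `x r`.  As `y = x * swap l r` agrees with `x` on those circles, the same then
holds for `y`. -/
def IsEmptyRegion (x : GridState n) (p : Fin n × Fin n) : Prop :=
  ∀ c, CycIoo p.1 p.2 c → ¬ CycIoo (x p.1) (x p.2) (x c)

open Classical in
/-- The number of markings of `S` in a region, the region being given by the predicate that
tells for column `c` and row `h` whether a marking in square `(c, h)` lies in it. -/
def markCount (S : Equiv.Perm (Fin n)) (region : Fin n → Fin n → Prop) : ℕ :=
  (Finset.univ.filter fun c => region c (S c)).card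

/-- The coefficient `U ^ (t * |X ∩ region| + (2 - t) * |O ∩ region|)`. -/
def regionWeight (t : ℝ≥0) (G : GridDiagram n) (region : Fin n → Fin n → Prop) : Rt t :=
  weight t (markCount G.X region) (markCount G.O region)

/-- The squares of the rectangle with sides on the vertical circles `p.1` and `p.2`. -/
def inRect (x : GridState n) (p : Fin n × Fin n) (c h : Fin n) : Prop :=
  CycIco (x p.1) (x p.2) h ∧ CycIco p.1 p.2 c

open Classical in
/-- The differential. -/
def differential (t : ℝ≥0) (G : GridDiagram n) : tGC t G →ₗ[Rt t] tGC t G :=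
  Fintype.linearCombination (Rt t) fun x =>
    ∑ y : GridState n, Pi.single y
      (∑ p ∈ (rect x y).filter (IsEmptyRegion x), regionWeight t G (inRect x p))

/-- The degree `d` part of the complex: the additive subgroup (that is, the `𝔽₂`-subspace, all
elements having order at most two) generated by the monomials `U ^ α · x` of `t`-grading `d`. -/
def tGCdeg (t : ℝ≥0) (G : GridDiagram n) (d : ℝ) : AddSubgroup (tGC t G) :=
  AddSubgroup.closure
    {m | ∃ (x : GridState n) (α : ℝ≥0) (hα : U α ∈ subringRt t),
      gr t G α x = d ∧ m = Pi.single x (monomial t α hα)}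

/-- The homology, as a module over `Rt t`. -/
abbrev tGH (t : ℝ≥0) (G : GridDiagram n) : Type :=
  LinearMap.ker (differential t G) ⧸
    (LinearMap.range (differential t G)).submoduleOf (LinearMap.ker (differential t G))

/-- The homology class of a cycle. -/
def tGHclass (t : ℝ≥0) (G : GridDiagram n) :
    LinearMap.ker (differential t G) →ₗ[Rt t] tGH t G :=
  Submodule.mkQ _

/-- The degree `d` part of the homology: the classes of the cycles of degree `d`.  It is the
quotient of the cycles of degree `d` by the boundaries of degree `d`. -/
def tGHdeg (t : ℝ≥0) (G : GridDiagram n) (d : ℝ) : AddSubgroup (tGH t G) :=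
  ((tGCdeg t G d).comap (LinearMap.ker (differential t G)).subtype.toAddMonoidHom).map
    (tGHclass t G).toAddMonoidHom

/-- An isomorphism of graded `Rt t`-modules between the homologies. -/
structure GradedIso (t : ℝ≥0) (G G' : GridDiagram n) where
  toEquiv : tGH t G ≃ₗ[Rt t] tGH t G'
  map_deg : ∀ (d : ℝ) (z : tGH t G), z ∈ tGHdeg t G d ↔ toEquiv z ∈ tGHdeg t G' d

/-! ### Pentagons and hexagons

For a column commutation at `i`, the diagrams `G` and `G' = G.swapColumns i (i + 1)` are drawn on
one torus, with the markings and all circles of `G` fixed.  The vertical circle `β` with number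
`i + 1`, which separates the columns `i` and `i + 1`, is replaced for `G'` by a circle `γ`
which has the markings of column `i` to its east and those of column `i + 1` to its west.
The circles `β` and `γ` meet in two points `a` and `b`, in the rows with numbers `a` and `b`;
going up, `γ` is to the east of `β` from `a` to `b`, and to the west of `β` from `b` to `a`.
A grid state of `G'` takes its point with vertical index `i + 1` on `γ`. -/

/-- `a` and `b` are the rows of the two intersection points in such a drawing: the markings of
column `i + 1` lie in the bigon going up from `a` to `b`, those of column `i` in the bigon going
up from `b` to `a`.  (A row that contains an intersection point may contain a marking of either
column, one below and the other above the point.) -/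
def IsDrawing [NeZero n] (G : GridDiagram n) (i a b : Fin n) : Prop :=
  a ≠ b ∧
  (CycIcc a b (G.X (i + 1)) ∧ CycIcc a b (G.O (i + 1))) ∧
  (CycIcc b a (G.X i) ∧ CycIcc b a (G.O i))

open Classical in
/-- Pentagons from a state `x` on the circles of `G` to a state `y` on the circles of `G'`,
encoded by the vertical indices `(l, r)` of their west and east sides; one of the two is `i + 1`,
and this side changes between `β` and `γ` at the intersection point `a`, so that row `a` is
between the bottom and the top side.  The corners are as for a rectangle, those in `x` with index
`i + 1` being on `β` and those in `y` with index `i + 1` on `γ`.  Hence the east side, if it has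
index `i + 1`, follows `γ` below `a` and `β` above `a`, and the west side, if it has index
`i + 1`, follows `β` below `a` and `γ` above `a`. -/
def pent [NeZero n] (i a : Fin n) (x y : GridState n) : Finset (Fin n × Fin n) :=
  (rect x y).filter fun p => (p.1 = i + 1 ∨ p.2 = i + 1) ∧ CycIco (x p.1) (x p.2) a

/-- Starting at the horizontal circle `s` and going up, a marking in square `(c, h)` is met before
the intersection point in row `a` at which `γ` passes from the west to the east of `β`.  In row
`a` itself, the markings of column `i` are below the intersection point and those of column
`i + 1` above it. -/
def IsBelowCrossing (i a s c h : Fin n) : Prop :=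
  CycIco s a h ∨ (h = a ∧ c = i)

/-- A marking in square `(c, h)` lies in the pentagon.  With respect to the circle `γ`, the
markings of column `i` lie in the column to the east of the circle with index `i + 1` and those of
column `i + 1` in the column to the west of it. -/
def inPent [NeZero n] (i a : Fin n) (x : GridState n) (p : Fin n × Fin n) (c h : Fin n) : Prop :=
  CycIco (x p.1) (x p.2) h ∧
  ((p.2 = i + 1 ∧
      ((IsBelowCrossing i a (x p.1) c h ∧ CycIco p.1 p.2 (Equiv.swap i (i + 1) c)) ∨
       (¬ IsBelowCrossing i a (x p.1) c h ∧ CycIco p.1 p.2 c))) ∨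
   (p.1 = i + 1 ∧
      ((IsBelowCrossing i a (x p.1) c h ∧ CycIco p.1 p.2 c) ∨
       (¬ IsBelowCrossing i a (x p.1) c h ∧ CycIco p.1 p.2 (Equiv.swap i (i + 1) c)))))

open Classical in
/-- The map from the complex of `G` to that of `G' = G.swapColumns i (i + 1)` counting empty
pentagons, for a drawing whose intersection point `a` is in row `a`.

Interchanging the roles of the two diagrams, and hence of the points `a` and `b`, the map in the
opposite direction is `pentagonMap t (G.swapColumns i (i + 1)) G i b`. -/
def pentagonMap [NeZero n] (t : ℝ≥0) (G G' : GridDiagram n) (i a : Fin n) :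
    tGC t G →ₗ[Rt t] tGC t G' :=
  Fintype.linearCombination (Rt t) fun x =>
    ∑ y : GridState n, Pi.single y
      (∑ p ∈ (pent i a x y).filter (IsEmptyRegion x), regionWeight t G (inPent i a x p))

open Classical in
/-- Hexagons between states on the circles of `G`: rectangles with one vertical side on `β`,
both intersection points being on that side, from which the bigon between the two points is cut
off by following `γ` instead of `β`.  On an east side `γ` has to be to the west of `β` between the
two points, so that `b` comes below `a`; on a west side `a` comes below `b`. -/
def hex [NeZero n] (i a b : Fin n) (x y : GridState n) : Finset (Fin n × Fin n) :=
  (rect x y).filter fun p =>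
    (p.2 = i + 1 ∧ CycIco (x p.1) (x p.2) a ∧ CycIco (x p.1) a b) ∨
    (p.1 = i + 1 ∧ CycIco (x p.1) (x p.2) b ∧ CycIco (x p.1) b a)

/-- A marking in square `(c, h)` lies in the hexagon.  The bigon cut off on an east side contains
exactly the markings of column `i`, the one cut off on a west side those of column `i + 1`. -/
def inHex [NeZero n] (i : Fin n) (x : GridState n) (p : Fin n × Fin n) (c h : Fin n) : Prop :=
  inRect x p c h ∧ (p.2 = i + 1 → c ≠ i) ∧ (p.1 = i + 1 → c ≠ i + 1)

open Classical in
/-- The endomorphism of the complex of `G` counting empty hexagons. -/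
def hexagonMap [NeZero n] (t : ℝ≥0) (G : GridDiagram n) (i a b : Fin n) :
    tGC t G →ₗ[Rt t] tGC t G :=
  Fintype.linearCombination (Rt t) fun x =>
    ∑ y : GridState n, Pi.single y
      (∑ p ∈ (hex i a b x y).filter (IsEmptyRegion x), regionWeight t G (inHex i x p))

end GridHomology

end

open GridHomology

/-!
The argument rests on two observations.

*The gradings determine the weights.* An empty rectangle, pentagon or hexagon from `x` to `y`
contributes a power of `U` whose exponent is the difference of the `t`-gradings of `y` and `x`, up
to a constant (`hasDegree_differential`, `hasDegree_pentagonMap`, `hasDegree_hexagonMap`). This is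
the relative Maslov formula on the torus, `maslovFormula`, together with the comparison of the
markings in a pentagon or a hexagon with those in the rectangle that has the same corners
(`markCount_inPent`, `markCount_inHex`). In the Hahn series with real exponents the coefficients of
a composite are therefore numbers modulo two times powers of `U` that depend on the end states
only (`toRealSeries_comp`), and identities between composites become identities between numbers
of pairs of empty rectangles. The markings play no further role.

*Juxtapositions of rectangles cancel in pairs with the same domain*, except for the decompositions
of the annuli of width one (`sum_pairTerm`). A pentagon is a rectangle with a side on circle `i + 1`
that passes the point `a`, and the parity of the number of such passages in a pair of rectangles is
a function of its domain; this gives the chain map property, `rectCount_pent_comm`. For the homotopy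
formula the boundary of a pair of rectangles is considered as a path on circle `i + 1`. A hexagon,
or a pentagon at `a` followed by one at `b`, is a passage of this path from `b` to `a`, and the
number of these passages is an iterated integral modulo two, so it depends only on the end point of
the path and its total displacement, and therefore only on the domain (`rectCount_hex`). The
identity map comes from the columns `i` and `i + 1`: their annuli run once around the circle, in
opposite directions, and exactly one of these two loops has an odd number of passages.

Cyclic permutations and the reflection in the diagonal preserve the relative Maslov formula and the
value of the Maslov function at the southwest corners of the markings, so they preserve the gradings
(`maslovInt_congr`); this reduces all commutation moves to planar column commutations.
-/

open scoped NNReal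

namespace GridHomology

variable {n : ℕ}

/-! ### Cyclic intervals -/

lemma val_sub_eq (a b : Fin n) :
    (a - b).val = if b.val ≤ a.val then a.val - b.val else n + a.val - b.val := by
  rw [Fin.sub_def]
  have ha := a.isLt
  have hb := b.isLt
  split_ifs with h
  · show (n - b.val + a.val) % n = _
    rw [show n - b.val + a.val = (a.val - b.val) + n by omega, Nat.add_mod_right,
      Nat.mod_eq_of_lt (by omega)]
  · show (n - b.val + a.val) % n = _
    rw [Nat.mod_eq_of_lt (by omega)]; omega

lemma cycIoo_iff (s t r : Fin n) : CycIoo s t r ↔ r ≠ s ∧ CycIco s t r := Iff.rfl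

lemma cycIco_iff (s t r : Fin n) : CycIco s t r ↔
    (s.val ≤ r.val ∧ r.val < t.val) ∨ (t.val < s.val ∧ (s.val ≤ r.val ∨ r.val < t.val)) := by
  unfold CycIco
  simp only [val_sub_eq]
  have := s.isLt; have := t.isLt; have := r.isLt
  split_ifs <;> omega

lemma cycIcc_iff (s t r : Fin n) : CycIcc s t r ↔
    (s.val ≤ r.val ∧ r.val ≤ t.val) ∨ (t.val < s.val ∧ (s.val ≤ r.val ∨ r.val ≤ t.val)) := by
  unfold CycIcc
  simp only [val_sub_eq]
  have := s.isLt; have := t.isLt; have := r.isLt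
  split_ifs <;> omega

lemma cycIoo_split {u v w : Fin n} (h : CycIoo u w v) {q : Fin n} (hq : q ≠ v) :
    CycIoo u w q ↔ CycIoo u v q ∨ CycIoo v w q := by
  simp only [cycIoo_iff, cycIco_iff, Fin.ne_iff_vne] at *
  omega

lemma cycIco_split {u v w : Fin n} (h : CycIoo u w v) (q : Fin n) :
    CycIco u w q ↔ CycIco u v q ∨ CycIco v w q := by
  simp only [cycIoo_iff, cycIco_iff, Fin.ne_iff_vne] at *
  omega

lemma cycIco_disj {u v w : Fin n} (h : CycIoo u w v) (q : Fin n) :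
    ¬ (CycIco u v q ∧ CycIco v w q) := by
  simp only [cycIoo_iff, cycIco_iff, Fin.ne_iff_vne] at *
  omega

lemma cycIoo_rotate {u v w : Fin n} (h : CycIoo u w v) : CycIoo v u w := by
  simp only [cycIoo_iff, cycIco_iff, Fin.ne_iff_vne] at *
  omega

lemma not_cycIoo_of_cycIoo {u v w : Fin n} (h : CycIoo u w v) : ¬ CycIoo u v w := by
  simp only [cycIoo_iff, cycIco_iff, Fin.ne_iff_vne] at *
  omega

lemma cycIoo_or {u v w : Fin n} (h1 : u ≠ v) (h2 : u ≠ w) (h3 : v ≠ w) :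
    CycIoo u w v ∨ CycIoo u v w := by
  simp only [cycIoo_iff, cycIco_iff, Fin.ne_iff_vne] at *
  omega

lemma not_cycIoo_left (u w : Fin n) : ¬ CycIoo u w u := fun h => h.1 rfl

lemma not_cycIoo_right (u w : Fin n) : ¬ CycIoo u w w := by
  simp only [cycIoo_iff, cycIco_iff, Fin.ne_iff_vne] at *
  omega

/-! ### Emptiness of two rectangles that share a vertical circle -/

/-- Emptiness of a region, with the conditions at three circles singled out. -/
lemma isEmptyRegion_iff_three (x : GridState n) (p : Fin n × Fin n) (u v w : Fin n) :
    IsEmptyRegion x p ↔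
      (CycIoo p.1 p.2 u → ¬ CycIoo (x p.1) (x p.2) (x u)) ∧
      (CycIoo p.1 p.2 v → ¬ CycIoo (x p.1) (x p.2) (x v)) ∧
      (CycIoo p.1 p.2 w → ¬ CycIoo (x p.1) (x p.2) (x w)) ∧
      ∀ q, q ≠ u → q ≠ v → q ≠ w → CycIoo p.1 p.2 q → ¬ CycIoo (x p.1) (x p.2) (x q) := by
  constructor
  · exact fun h => ⟨h u, h v, h w, fun q _ _ _ => h q⟩
  · rintro ⟨hu, hv, hw, h⟩ q
    by_cases h1 : q = u
    · exact h1 ▸ hu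
    by_cases h2 : q = v
    · exact h2 ▸ hv
    by_cases h3 : q = w
    · exact h3 ▸ hw
    exact h q h1 h2 h3

section triple
variable (x : GridState n) {u v w : Fin n}

lemma cycIoo_ne {u v w : Fin n} (h : CycIoo u w v) : u ≠ v ∧ u ≠ w ∧ v ≠ w := by
  simp only [cycIoo_iff, cycIco_iff, Fin.ne_iff_vne] at *
  omega

/-- Two successive rectangles that share the circle `v` and lie on its two sides, and share their
south side, form an L-shaped domain. If `x w` is the lower of the two northern heights, cutting from
the reflex corner in the other direction gives two rectangles that share the west circle `u`; the
third order in which the same permutation arises is not empty. -/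
lemma empty_middle_iff_left (h : CycIoo u w v) (hx : CycIoo (x u) (x v) (x w)) :
    ((IsEmptyRegion x (u, v) ∧ IsEmptyRegion (x * Equiv.swap u v) (v, w)) ↔
      (IsEmptyRegion x (u, w) ∧ IsEmptyRegion (x * Equiv.swap u w) (u, v))) ∧
    ¬ (IsEmptyRegion x (v, w) ∧ IsEmptyRegion (x * Equiv.swap v w) (u, w)) := by
  obtain ⟨h1, h2, h3⟩ := cycIoo_ne h
  simp only [isEmptyRegion_iff_three _ _ u v w, Equiv.Perm.mul_apply, Equiv.swap_apply_left,
    Equiv.swap_apply_right, Equiv.swap_apply_of_ne_of_ne h1 h2,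
    Equiv.swap_apply_of_ne_of_ne h1.symm h3, Equiv.swap_apply_of_ne_of_ne h2.symm h3.symm]
  have e1 := cycIoo_rotate h
  have f1 := not_cycIoo_of_cycIoo h
  have f2 := not_cycIoo_of_cycIoo e1
  have g1 := cycIoo_rotate hx
  have g2 := cycIoo_rotate g1
  have k1 := not_cycIoo_of_cycIoo hx
  have k2 := not_cycIoo_of_cycIoo g1
  simp only [not_cycIoo_left, not_cycIoo_right, f1, f2, g2, k1, k2, h, hx, not_false_eq_true,
    not_true_eq_false, imp_true_iff, true_and, and_true, imp_false, false_and, and_false]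
  rw [← forall_and, ← forall_and]
  refine forall_congr' fun q => ?_
  by_cases hq1 : q = u
  · simp [hq1]
  by_cases hq2 : q = v
  · simp [hq2]
  by_cases hq3 : q = w
  · simp [hq3]
  simp only [Equiv.swap_apply_of_ne_of_ne hq1 hq2, Equiv.swap_apply_of_ne_of_ne hq1 hq3,
    hq1, hq2, hq3, ne_eq, not_false_eq_true,
    true_imp_iff, cycIoo_split h hq2, cycIoo_split hx (x.injective.ne hq3)]
  clear e1 f1 f2 g1 g2 k1 k2 h hx
  tauto

/-- The case of `empty_middle_iff_left` in which `x v` is the lower of the two northern heights: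
the other decomposition consists of two rectangles that share the east circle `w`. -/
lemma empty_middle_iff_right (h : CycIoo u w v) (hx : CycIoo (x u) (x w) (x v)) :
    ((IsEmptyRegion x (u, v) ∧ IsEmptyRegion (x * Equiv.swap u v) (v, w)) ↔
      (IsEmptyRegion x (v, w) ∧ IsEmptyRegion (x * Equiv.swap v w) (u, w))) ∧
    ¬ (IsEmptyRegion x (u, w) ∧ IsEmptyRegion (x * Equiv.swap u w) (u, v)) := by
  obtain ⟨h1, h2, h3⟩ := cycIoo_ne h
  simp only [isEmptyRegion_iff_three _ _ u v w, Equiv.Perm.mul_apply, Equiv.swap_apply_left,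
    Equiv.swap_apply_right, Equiv.swap_apply_of_ne_of_ne h1 h2,
    Equiv.swap_apply_of_ne_of_ne h1.symm h3, Equiv.swap_apply_of_ne_of_ne h2.symm h3.symm]
  have e1 := cycIoo_rotate h
  have f1 := not_cycIoo_of_cycIoo h
  have f2 := not_cycIoo_of_cycIoo e1
  have g1 := cycIoo_rotate hx
  have g2 := cycIoo_rotate g1
  have k1 := not_cycIoo_of_cycIoo hx
  have k2 := not_cycIoo_of_cycIoo g1
  simp only [not_cycIoo_left, not_cycIoo_right, f1, f2, g2, k1, k2, h, hx, not_false_eq_true,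
    not_true_eq_false, imp_true_iff, true_and, and_true, imp_false, false_and, and_false]
  rw [← forall_and, ← forall_and]
  refine forall_congr' fun q => ?_
  by_cases hq1 : q = u
  · simp [hq1]
  by_cases hq2 : q = v
  · simp [hq2]
  by_cases hq3 : q = w
  · simp [hq3]
  simp only [Equiv.swap_apply_of_ne_of_ne hq1 hq2,
    Equiv.swap_apply_of_ne_of_ne hq2 hq3, hq1, hq2, hq3, ne_eq, not_false_eq_true,
    true_imp_iff, cycIoo_split h hq2, cycIoo_split hx (x.injective.ne hq2)]
  clear e1 f1 f2 g1 g2 k1 k2 h hx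
  tauto

/-- The analogue of `empty_middle_iff_right` when the eastern rectangle is used first, so that the
two rectangles share their north side; the other decomposition shares the west circle `u`. -/
lemma empty_outer_iff_left (h : CycIoo u w v) (hx : CycIoo (x u) (x w) (x v)) :
    ((IsEmptyRegion x (v, w) ∧ IsEmptyRegion (x * Equiv.swap v w) (u, v)) ↔
      (IsEmptyRegion x (u, v) ∧ IsEmptyRegion (x * Equiv.swap u v) (u, w))) ∧
    ¬ (IsEmptyRegion x (u, w) ∧ IsEmptyRegion (x * Equiv.swap u w) (v, w)) := by
  obtain ⟨h1, h2, h3⟩ := cycIoo_ne h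
  simp only [isEmptyRegion_iff_three _ _ u v w, Equiv.Perm.mul_apply, Equiv.swap_apply_left,
    Equiv.swap_apply_right, Equiv.swap_apply_of_ne_of_ne h1 h2,
    Equiv.swap_apply_of_ne_of_ne h1.symm h3, Equiv.swap_apply_of_ne_of_ne h2.symm h3.symm]
  have e1 := cycIoo_rotate h
  have f1 := not_cycIoo_of_cycIoo h
  have f2 := not_cycIoo_of_cycIoo e1
  have g1 := cycIoo_rotate hx
  have k1 := not_cycIoo_of_cycIoo hx
  have k2 := not_cycIoo_of_cycIoo g1
  simp only [not_cycIoo_left, not_cycIoo_right, f1, f2, g1, k1, k2, h, hx,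
    not_false_eq_true, not_true_eq_false, imp_true_iff, true_and, and_true,
    imp_false, false_and, and_false]
  rw [← forall_and, ← forall_and]
  refine forall_congr' fun q => ?_
  by_cases hq1 : q = u
  · simp [hq1]
  by_cases hq2 : q = v
  · simp [hq2]
  by_cases hq3 : q = w
  · simp [hq3]
  simp only [Equiv.swap_apply_of_ne_of_ne hq1 hq2,
    Equiv.swap_apply_of_ne_of_ne hq2 hq3, hq1, hq2, hq3, ne_eq, not_false_eq_true,
    true_imp_iff, cycIoo_split h hq2, cycIoo_split hx (x.injective.ne hq2)]
  clear e1 f1 f2 g1 k1 k2 h hx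
  tauto

/-- The analogue of `empty_middle_iff_left` when the eastern rectangle is used first; the other
decomposition shares the east circle `w`. -/
lemma empty_outer_iff_right (h : CycIoo u w v) (hx : CycIoo (x u) (x v) (x w)) :
    ((IsEmptyRegion x (v, w) ∧ IsEmptyRegion (x * Equiv.swap v w) (u, v)) ↔
      (IsEmptyRegion x (u, w) ∧ IsEmptyRegion (x * Equiv.swap u w) (v, w))) ∧
    ¬ (IsEmptyRegion x (u, v) ∧ IsEmptyRegion (x * Equiv.swap u v) (u, w)) := by
  obtain ⟨h1, h2, h3⟩ := cycIoo_ne h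
  simp only [isEmptyRegion_iff_three _ _ u v w, Equiv.Perm.mul_apply, Equiv.swap_apply_left,
    Equiv.swap_apply_right, Equiv.swap_apply_of_ne_of_ne h1 h2,
    Equiv.swap_apply_of_ne_of_ne h1.symm h3, Equiv.swap_apply_of_ne_of_ne h2.symm h3.symm]
  have e1 := cycIoo_rotate h
  have f1 := not_cycIoo_of_cycIoo h
  have f2 := not_cycIoo_of_cycIoo e1
  have g1 := cycIoo_rotate hx
  have g2 := cycIoo_rotate g1
  have k1 := not_cycIoo_of_cycIoo hx
  have k3 := not_cycIoo_of_cycIoo g2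
  simp only [not_cycIoo_left, not_cycIoo_right, f1, f2, g2, k1, k3, h, hx,
    not_false_eq_true, not_true_eq_false, imp_true_iff, true_and, and_true,
    imp_false, false_and, and_false]
  rw [← forall_and, ← forall_and]
  refine forall_congr' fun q => ?_
  by_cases hq1 : q = u
  · simp [hq1]
  by_cases hq2 : q = v
  · simp [hq2]
  by_cases hq3 : q = w
  · simp [hq3]
  simp only [Equiv.swap_apply_of_ne_of_ne hq1 hq3,
    Equiv.swap_apply_of_ne_of_ne hq2 hq3, hq1, hq2, hq3, ne_eq, not_false_eq_true,
    true_imp_iff, cycIoo_split h hq2, cycIoo_split g2 (x.injective.ne hq1)]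
  clear e1 f1 f2 g1 g2 k1 k3 h hx
  tauto

end triple

open Classical in
/-- The domain of a rectangle, as the function that assigns to every square its multiplicity. -/
noncomputable def dom (x : GridState n) (p : Fin n × Fin n) : Fin n → Fin n → ℕ :=
  fun c h => if inRect x p c h then 1 else 0

open Classical in
lemma dom_mk (x : GridState n) (l r : Fin n) {s t : Fin n} (hs : x l = s) (ht : x r = t)
    (c h : Fin n) : dom x (l, r) c h = if CycIco s t h ∧ CycIco l r c then 1 else 0 := by
  subst hs ht
  unfold dom inRect
  congr

section
variable {x : GridState n} {u v w : Fin n}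

/-- In the other cyclic order of the circles the two rectangles overlap, and the first one or the
second one contains a point of its initial state. -/
lemma not_empty_middle (h : CycIoo u v w) :
    ¬ (IsEmptyRegion x (u, v) ∧ IsEmptyRegion (x * Equiv.swap u v) (v, w)) := by
  rintro ⟨h1, h2⟩
  obtain ⟨n1, n2, n3⟩ := cycIoo_ne h
  have h3 := h1 w h
  have h4 := h2 u (cycIoo_rotate (cycIoo_rotate h))
  simp only [Equiv.Perm.mul_apply, Equiv.swap_apply_left, Equiv.swap_apply_right,
    Equiv.swap_apply_of_ne_of_ne n1.symm n3] at h3 h4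
  rcases cycIoo_or (x.injective.ne n1) (x.injective.ne n2) (x.injective.ne n3) with h5 | h5
  exacts [h3 h5, h4 h5]

/-- The analogue of `not_empty_middle` for the pairs whose second rectangle ends on the west side of
the first. -/
lemma not_empty_outer (h : CycIoo u v w) :
    ¬ (IsEmptyRegion x (v, w) ∧ IsEmptyRegion (x * Equiv.swap v w) (u, v)) := by
  rintro ⟨h1, h2⟩
  obtain ⟨n1, n2, n3⟩ := cycIoo_ne h
  have h3 := h1 u (cycIoo_rotate (cycIoo_rotate h))
  have h4 := h2 w h
  simp only [Equiv.Perm.mul_apply, Equiv.swap_apply_left, Equiv.swap_apply_right,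
    Equiv.swap_apply_of_ne_of_ne n2 n1] at h3 h4
  rcases cycIoo_or (x.injective.ne n1) (x.injective.ne n2) (x.injective.ne n3) with h5 | h5
  exacts [h3 (cycIoo_rotate (cycIoo_rotate h5)), h4 h5]

lemma dom_middle_eq_left (h : CycIoo u w v) (hx : CycIoo (x u) (x v) (x w)) :
    dom x (u, v) + dom (x * Equiv.swap u v) (v, w) =
      dom x (u, w) + dom (x * Equiv.swap u w) (u, v) := by
  obtain ⟨n1, n2, n3⟩ := cycIoo_ne h
  have m1 := n1.symm
  have m2 := n2.symm
  have m3 := n3.symm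
  classical
  funext c k
  have h1 := cycIco_split h c
  have h2 := cycIco_disj h c
  have h3 := cycIco_split hx k
  have h4 := cycIco_disj hx k
  simp only [Pi.add_apply]
  rw [dom_mk x u v rfl rfl,
    dom_mk (x * Equiv.swap u v) v w (s := x u) (t := x w)
      (by simp [*]) (by simp [Equiv.swap_apply_def, *]),
    dom_mk x u w rfl rfl,
    dom_mk (x * Equiv.swap u w) u v (s := x w) (t := x v)
      (by simp [*]) (by simp [Equiv.swap_apply_def, *])]
  simp only [h1, h3]
  by_cases CycIco u v c <;> by_cases CycIco v w c <;> by_cases CycIco (x u) (x w) k <;>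
    by_cases CycIco (x w) (x v) k <;> simp_all

lemma dom_middle_eq_right (h : CycIoo u w v) (hx : CycIoo (x u) (x w) (x v)) :
    dom x (u, v) + dom (x * Equiv.swap u v) (v, w) =
      dom x (v, w) + dom (x * Equiv.swap v w) (u, w) := by
  obtain ⟨n1, n2, n3⟩ := cycIoo_ne h
  have m1 := n1.symm
  have m2 := n2.symm
  have m3 := n3.symm
  classical
  funext c k
  have h1 := cycIco_split h c
  have h2 := cycIco_disj h c
  have h3 := cycIco_split hx k
  have h4 := cycIco_disj hx k
  simp only [Pi.add_apply]
  rw [dom_mk x u v rfl rfl,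
    dom_mk (x * Equiv.swap u v) v w (s := x u) (t := x w)
      (by simp [*]) (by simp [Equiv.swap_apply_def, *]),
    dom_mk x v w rfl rfl,
    dom_mk (x * Equiv.swap v w) u w (s := x u) (t := x v)
      (by simp [Equiv.swap_apply_def, *]) (by simp [*])]
  simp only [h1, h3]
  by_cases CycIco u v c <;> by_cases CycIco v w c <;> by_cases CycIco (x u) (x v) k <;>
    by_cases CycIco (x v) (x w) k <;> simp_all

lemma dom_outer_eq_left (h : CycIoo u w v) (hx : CycIoo (x u) (x w) (x v)) :
    dom x (v, w) + dom (x * Equiv.swap v w) (u, v) =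
      dom x (u, v) + dom (x * Equiv.swap u v) (u, w) := by
  obtain ⟨n1, n2, n3⟩ := cycIoo_ne h
  have m1 := n1.symm
  have m2 := n2.symm
  have m3 := n3.symm
  classical
  funext c k
  have h1 := cycIco_split h c
  have h2 := cycIco_disj h c
  have h3 := cycIco_split hx k
  have h4 := cycIco_disj hx k
  simp only [Pi.add_apply]
  rw [dom_mk x v w rfl rfl,
    dom_mk (x * Equiv.swap v w) u v (s := x u) (t := x w)
      (by simp [Equiv.swap_apply_def, *]) (by simp [*]),
    dom_mk x u v rfl rfl,
    dom_mk (x * Equiv.swap u v) u w (s := x v) (t := x w)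
      (by simp [*]) (by simp [Equiv.swap_apply_def, *])]
  simp only [h1, h3]
  by_cases CycIco u v c <;> by_cases CycIco v w c <;> by_cases CycIco (x u) (x v) k <;>
    by_cases CycIco (x v) (x w) k <;> simp_all

lemma dom_outer_eq_right (h : CycIoo u w v) (hx : CycIoo (x u) (x v) (x w)) :
    dom x (v, w) + dom (x * Equiv.swap v w) (u, v) =
      dom x (u, w) + dom (x * Equiv.swap u w) (v, w) := by
  obtain ⟨n1, n2, n3⟩ := cycIoo_ne h
  have m1 := n1.symm
  have m2 := n2.symm
  have m3 := n3.symm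
  classical
  funext c k
  have h1 := cycIco_split h c
  have h2 := cycIco_disj h c
  have h3 := cycIco_split (cycIoo_rotate (cycIoo_rotate hx)) k
  have h4 := cycIco_disj (cycIoo_rotate (cycIoo_rotate hx)) k
  simp only [Pi.add_apply]
  rw [dom_mk x v w rfl rfl,
    dom_mk (x * Equiv.swap v w) u v (s := x u) (t := x w)
      (by simp [Equiv.swap_apply_def, *]) (by simp [*]),
    dom_mk x u w rfl rfl,
    dom_mk (x * Equiv.swap u w) v w (s := x v) (t := x u)
      (by simp [Equiv.swap_apply_def, *]) (by simp [*])]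
  simp only [h1, h3]
  by_cases CycIco u v c <;> by_cases CycIco v w c <;> by_cases CycIco (x v) (x u) k <;>
    by_cases CycIco (x u) (x w) k <;> simp_all

end

/-! ### Cancellation of pairs of rectangles -/

lemma cycIoo_right_mem {l r l' r' : Fin n} (h : CycIoo l' r' l) (h' : ¬ CycIoo l' r' r)
    (h1 : r ≠ l') (h2 : r ≠ r') : CycIoo l r r' := by
  simp only [cycIoo_iff, cycIco_iff, Fin.ne_iff_vne] at *
  omega

lemma cycIoo_left_mem {l r l' r' : Fin n} (h : CycIoo l' r' r) (h' : ¬ CycIoo l' r' l)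
    (h1 : l ≠ l') (h2 : l ≠ r') : CycIoo l r l' := by
  simp only [cycIoo_iff, cycIco_iff, Fin.ne_iff_vne] at *
  omega

/-- Two successive empty rectangles without a common vertical circle can be taken in the other
order. -/
lemma empty_comm {x : GridState n} {l r l' r' : Fin n} (h1 : l' ≠ l) (h2 : l' ≠ r)
    (h3 : r' ≠ l) (h4 : r' ≠ r)
    (h : IsEmptyRegion x (l, r) ∧ IsEmptyRegion (x * Equiv.swap l r) (l', r')) :
    IsEmptyRegion x (l', r') ∧ IsEmptyRegion (x * Equiv.swap l' r') (l, r) := by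
  obtain ⟨E1, E2⟩ := h
  have hl := E2 l
  have hr := E2 r
  have hl' := E1 l'
  have hr' := E1 r'
  simp only [Equiv.Perm.mul_apply, Equiv.swap_apply_left, Equiv.swap_apply_right,
    Equiv.swap_apply_of_ne_of_ne h1 h2, Equiv.swap_apply_of_ne_of_ne h3 h4] at hl hr
  have i := x.injective
  constructor
  · intro q hq hx
    simp only at hq hx
    by_cases q1 : q = l
    · subst q1
      exact hr' (cycIoo_right_mem hq (fun e => hr e hx) h2.symm h4.symm)
        (cycIoo_right_mem hx (hl hq) (i.ne h2.symm) (i.ne h4.symm))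
    by_cases q2 : q = r
    · subst q2
      exact hl' (cycIoo_left_mem hq (fun e => hl e hx) h1.symm h3.symm)
        (cycIoo_left_mem hx (hr hq) (i.ne h1.symm) (i.ne h3.symm))
    have := E2 q hq
    simp only [Equiv.Perm.mul_apply, Equiv.swap_apply_of_ne_of_ne q1 q2,
      Equiv.swap_apply_of_ne_of_ne h1 h2, Equiv.swap_apply_of_ne_of_ne h3 h4] at this
    exact this hx
  · intro q hq hx
    simp only [Equiv.Perm.mul_apply, Equiv.swap_apply_of_ne_of_ne h1.symm h3.symm,
      Equiv.swap_apply_of_ne_of_ne h2.symm h4.symm] at hq hx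
    by_cases q1 : q = l'
    · subst q1
      rw [Equiv.swap_apply_left] at hx
      exact hr (cycIoo_right_mem hq (fun e => hr' e hx) h3 h4)
        (cycIoo_left_mem hx (hl' hq) (i.ne h1) (i.ne h2))
    by_cases q2 : q = r'
    · subst q2
      rw [Equiv.swap_apply_right] at hx
      exact hl (cycIoo_left_mem hq (fun e => hl' e hx) h1 h2)
        (cycIoo_right_mem hx (hr' hq) (i.ne h3) (i.ne h4))
    rw [Equiv.swap_apply_of_ne_of_ne q1 q2] at hx
    exact E1 q hq hx

open Classical in
/-- The contribution to the square of a weighted differential, in the component from `x` to `z`,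
of the pair of the rectangle `(l, r)` and the rectangle `(l', r')` following it. The weight of
the pair is the value of `f` on its domain. -/
noncomputable def pairTerm (f : (Fin n → Fin n → ℕ) → ZMod 2) (x z : GridState n)
    (l r l' r' : Fin n) : ZMod 2 :=
  if (l ≠ r ∧ l' ≠ r') ∧
      (IsEmptyRegion x (l, r) ∧ IsEmptyRegion (x * Equiv.swap l r) (l', r')) ∧
      z = x * (Equiv.swap l r * Equiv.swap l' r')
  then f (dom x (l, r) + dom (x * Equiv.swap l r) (l', r')) else 0

section
variable (f : (Fin n → Fin n → ℕ) → ZMod 2) (x z : GridState n)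

lemma pairTerm_congr {l r l' r' m s m' s' : Fin n} (h1 : l ≠ r) (h2 : l' ≠ r') (h3 : m ≠ s)
    (h4 : m' ≠ s')
    (hE : (IsEmptyRegion x (l, r) ∧ IsEmptyRegion (x * Equiv.swap l r) (l', r')) ↔
      (IsEmptyRegion x (m, s) ∧ IsEmptyRegion (x * Equiv.swap m s) (m', s')))
    (hd : dom x (l, r) + dom (x * Equiv.swap l r) (l', r') =
      dom x (m, s) + dom (x * Equiv.swap m s) (m', s'))
    (hs : Equiv.swap l r * Equiv.swap l' r' = Equiv.swap m s * Equiv.swap m' s') :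
    pairTerm f x z l r l' r' = pairTerm f x z m s m' s' := by
  unfold pairTerm
  classical
  rw [hd, hs]
  exact if_congr (by tauto) rfl rfl

lemma pairTerm_eq_zero {l r l' r' : Fin n}
    (hE : ¬ (IsEmptyRegion x (l, r) ∧ IsEmptyRegion (x * Equiv.swap l r) (l', r'))) :
    pairTerm f x z l r l' r' = 0 :=
  if_neg fun h => hE h.2.1

lemma pairTerm_comm {l r l' r' : Fin n} (h1 : l' ≠ l) (h2 : l' ≠ r) (h3 : r' ≠ l) (h4 : r' ≠ r) :
    pairTerm f x z l r l' r' = pairTerm f x z l' r' l r := by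
  by_cases h5 : l = r
  · simp [pairTerm, h5]
  by_cases h6 : l' = r'
  · simp [pairTerm, h6]
  have m1 := h1.symm
  have m2 := h2.symm
  have m3 := h3.symm
  have m4 := h4.symm
  refine pairTerm_congr f x z h5 h6 h6 h5 ⟨empty_comm h1 h2 h3 h4,
    empty_comm h1.symm h3.symm h2.symm h4.symm⟩ ?_ ?_
  · have e1 : dom (x * Equiv.swap l r) (l', r') = dom x (l', r') := by
      funext c h
      rw [dom_mk x l' r' rfl rfl, dom_mk _ l' r' (s := x l') (t := x r')] <;>
        simp [Equiv.swap_apply_def, *]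
    have e2 : dom (x * Equiv.swap l' r') (l, r) = dom x (l, r) := by
      funext c h
      rw [dom_mk x l r rfl rfl, dom_mk _ l r (s := x l) (t := x r)] <;>
        simp [Equiv.swap_apply_def, *]
    rw [e1, e2, add_comm]
  · exact (Equiv.Perm.Disjoint.commute (Equiv.Perm.disjoint_iff_disjoint_support.mpr (by
      rw [Equiv.Perm.support_swap h5, Equiv.Perm.support_swap h6]; simp [*]))).eq

lemma swap_mul_swap_eq {u v w : Fin n} (h1 : u ≠ v) (h2 : u ≠ w) (h3 : v ≠ w) :
    Equiv.swap u v * Equiv.swap v w = Equiv.swap u w * Equiv.swap u v := by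
  ext q : 1
  simp only [Equiv.Perm.mul_apply, Equiv.swap_apply_def]
  split_ifs <;> simp_all

/-- For three circles in cyclic order, the pair of rectangles on the two sides of the middle circle,
western one first, cancels the pair with a common west side or the one with a common east side,
depending on the cyclic order of the heights; the remaining pair vanishes. -/
lemma pairTerm_cancel_middle {u v w : Fin n} (h : CycIoo u w v) :
    pairTerm f x z u v v w + pairTerm f x z u w u v + pairTerm f x z v w u w = 0 := by
  obtain ⟨n1, n2, n3⟩ := cycIoo_ne h
  have i := x.injective
  have s1 := swap_mul_swap_eq n1 n2 n3
  have s2 : Equiv.swap u v * Equiv.swap v w = Equiv.swap v w * Equiv.swap u w := by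
    have := swap_mul_swap_eq n3 n1.symm n2.symm
    rw [Equiv.swap_comm w u, Equiv.swap_comm v u] at this
    exact this.symm
  rcases cycIoo_or (i.ne n1) (i.ne n2) (i.ne n3) with hx | hx
  · obtain ⟨hE, hE'⟩ := empty_middle_iff_right x h hx
    rw [pairTerm_congr f x z n1 n3 n3 n2 hE (dom_middle_eq_right h hx) s2,
      pairTerm_eq_zero f x z hE', add_zero, CharTwo.add_self_eq_zero]
  · obtain ⟨hE, hE'⟩ := empty_middle_iff_left x h hx
    rw [pairTerm_congr f x z n1 n3 n2 n1 hE (dom_middle_eq_left h hx) s1,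
      pairTerm_eq_zero f x z hE', add_zero, CharTwo.add_self_eq_zero]

/-- The analogue of `pairTerm_cancel_middle` for the two rectangles on the sides of the middle
circle, eastern one first. -/
lemma pairTerm_cancel_outer {u v w : Fin n} (h : CycIoo u w v) :
    pairTerm f x z v w u v + pairTerm f x z u v u w + pairTerm f x z u w v w = 0 := by
  obtain ⟨n1, n2, n3⟩ := cycIoo_ne h
  have i := x.injective
  have s1 : Equiv.swap v w * Equiv.swap u v = Equiv.swap u w * Equiv.swap v w := by
    have := swap_mul_swap_eq n3.symm n2.symm n1.symm
    rwa [Equiv.swap_comm w v, Equiv.swap_comm v u, Equiv.swap_comm w u] at this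
  have s2 : Equiv.swap v w * Equiv.swap u v = Equiv.swap u v * Equiv.swap u w := by
    have := swap_mul_swap_eq n1.symm n3 n2
    rw [Equiv.swap_comm v u] at this
    rw [this]
  rcases cycIoo_or (i.ne n1) (i.ne n2) (i.ne n3) with hx | hx
  · obtain ⟨hE, hE'⟩ := empty_outer_iff_left x h hx
    rw [pairTerm_congr f x z n3 n1 n1 n2 hE (dom_outer_eq_left h hx) s2,
      pairTerm_eq_zero f x z hE', add_zero, CharTwo.add_self_eq_zero]
  · obtain ⟨hE, hE'⟩ := empty_outer_iff_right x h hx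
    rw [pairTerm_congr f x z n3 n1 n2 n3 hE (dom_outer_eq_right h hx) s1,
      pairTerm_eq_zero f x z hE', add_zero, CharTwo.add_self_eq_zero]

end

section
variable (f : (Fin n → Fin n → ℕ) → ZMod 2) (x z : GridState n)

lemma pairTerm_eq_zero_of_eq {l r l' r' : Fin n} (hz : z ≠ x)
    (h : l' = l ∧ r' = r ∨ l' = r ∧ r' = l) : pairTerm f x z l r l' r' = 0 := by
  refine if_neg fun hh => hz ?_
  rw [hh.2.2]
  rcases h with ⟨rfl, rfl⟩ | ⟨rfl, rfl⟩
  · simp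
  · rw [Equiv.swap_comm l' r', Equiv.swap_mul_self, mul_one]

lemma pairTerm_eq_zero_left {l l' r' : Fin n} : pairTerm f x z l l l' r' = 0 := by
  simp [pairTerm]

lemma pairTerm_eq_zero_right {l r l' : Fin n} : pairTerm f x z l r l' l' = 0 := by
  simp [pairTerm]

/-- For two different states, the pairs of rectangles are sorted according to the circle that the
two rectangles share, if any. -/
lemma pairTerm_split (hz : z ≠ x) (l r l' r' : Fin n) :
    pairTerm f x z l r l' r' =
      (if l' ≠ l ∧ l' ≠ r ∧ r' ≠ l ∧ r' ≠ r then pairTerm f x z l r l' r' else 0) +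
      (if l' = l then pairTerm f x z l r l r' else 0) +
      (if r' = r then pairTerm f x z l r l' r else 0) +
      (if l' = r then pairTerm f x z l r r r' else 0) +
      (if r' = l then pairTerm f x z l r l' l else 0) := by
  have h1 := pairTerm_eq_zero_of_eq f x z (l := l) (r := r) (l' := l) (r' := r) hz (by simp)
  have h2 := pairTerm_eq_zero_of_eq f x z (l := l) (r := r) (l' := r) (r' := l) hz (by simp)
  by_cases hlr : l = r
  · subst hlr; simp [pairTerm_eq_zero_left]
  by_cases hlr' : l' = r'
  · subst hlr'
    split_ifs <;> simp_all [pairTerm_eq_zero_right]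
  by_cases a1 : l' = l <;> by_cases a2 : l' = r <;> by_cases a3 : r' = l <;>
    by_cases a4 : r' = r <;> simp_all [pairTerm_eq_zero_right]

open Classical in
/-- Sum over the cyclically ordered triples of circles. -/
noncomputable def cycSum (g : Fin n → Fin n → Fin n → ZMod 2) : ZMod 2 :=
  ∑ u, ∑ v, ∑ w, if CycIoo u w v then g u v w else 0

open Classical in
lemma sum_pairTerm_disjoint :
    (∑ l, ∑ r, ∑ l', ∑ r', if l' ≠ l ∧ l' ≠ r ∧ r' ≠ l ∧ r' ≠ r then
      pairTerm f x z l r l' r' else 0) = 0 := by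
  have : ∀ F : Fin n → Fin n → Fin n → Fin n → ZMod 2, (∑ l, ∑ r, ∑ l', ∑ r', F l r l' r') =
      ∑ p : (Fin n × Fin n) × (Fin n × Fin n), F p.1.1 p.1.2 p.2.1 p.2.2 := by
    intro F
    simp only [Fintype.sum_prod_type]
  rw [this]
  refine Finset.sum_involution (fun p _ => (p.2, p.1)) ?_ ?_ (by simp) (by simp)
  · rintro ⟨⟨l, r⟩, l', r'⟩ -
    by_cases h : l' ≠ l ∧ l' ≠ r ∧ r' ≠ l ∧ r' ≠ r
    · have h' : l ≠ l' ∧ l ≠ r' ∧ r ≠ l' ∧ r ≠ r' :=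
        ⟨h.1.symm, h.2.2.1.symm, h.2.1.symm, h.2.2.2.symm⟩
      simp only [if_pos h, if_pos h']
      rw [pairTerm_comm f x z h.1 h.2.1 h.2.2.1 h.2.2.2, CharTwo.add_self_eq_zero]
    · have h' : ¬ (l ≠ l' ∧ l ≠ r' ∧ r ≠ l' ∧ r ≠ r') := by tauto
      simp only [if_neg h, if_neg h', add_zero]
  · rintro ⟨⟨l, r⟩, l', r'⟩ - h e
    simp only [Prod.mk.injEq] at e
    simp [e.1.1] at h

/-- Ordering the two other circles cyclically sorts the pairs of rectangles with a common west side
into the two kinds that occur in `pairTerm_cancel_middle` and `pairTerm_cancel_outer`. -/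
lemma sum_share_left (hz : z ≠ x) : ∑ l, ∑ r, ∑ s, pairTerm f x z l r l s =
    cycSum (fun u v w => pairTerm f x z u w u v) +
      cycSum (fun u v w => pairTerm f x z u v u w) := by
  classical
  have : ∀ l r s : Fin n, pairTerm f x z l r l s =
      (if CycIoo l r s then pairTerm f x z l r l s else 0) +
        (if CycIoo l s r then pairTerm f x z l r l s else 0) := by
    intro l r s
    by_cases h1 : l = r
    · subst h1; simp [pairTerm_eq_zero_left]
    by_cases h2 : l = s
    · subst h2; simp [pairTerm_eq_zero_right]
    by_cases h3 : r = s
    · subst h3; simp [pairTerm_eq_zero_of_eq f x z hz]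
    rcases cycIoo_or h1 h2 h3 with h | h <;> simp [h, not_cycIoo_of_cycIoo h]
  rw [Finset.sum_congr rfl fun l _ => Finset.sum_congr rfl fun r _ =>
    Finset.sum_congr rfl fun s _ => this l r s]
  simp only [Finset.sum_add_distrib]
  unfold cycSum
  refine congrArg₂ (· + ·) (Finset.sum_congr rfl fun l _ => Finset.sum_comm) rfl

lemma sum_share_right (hz : z ≠ x) : ∑ l, ∑ r, ∑ s, pairTerm f x z l r s r =
    cycSum (fun u v w => pairTerm f x z u w v w) +
      cycSum (fun u v w => pairTerm f x z v w u w) := by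
  classical
  have : ∀ l r s : Fin n, pairTerm f x z l r s r =
      (if CycIoo l r s then pairTerm f x z l r s r else 0) +
        (if CycIoo s r l then pairTerm f x z l r s r else 0) := by
    intro l r s
    by_cases h1 : l = r
    · subst h1; simp [pairTerm_eq_zero_left]
    by_cases h2 : s = r
    · subst h2; simp [pairTerm_eq_zero_right]
    by_cases h3 : l = s
    · subst h3; simp [pairTerm_eq_zero_of_eq f x z hz]
    rcases cycIoo_or h1 h3 (Ne.symm h2) with h | h
    · have h' := cycIoo_rotate (cycIoo_rotate h)
      have := not_cycIoo_of_cycIoo h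
      simp [h', this]
    · have h' := not_cycIoo_of_cycIoo (cycIoo_rotate h)
      simp [h, h']
  rw [Finset.sum_congr rfl fun l _ => Finset.sum_congr rfl fun r _ =>
    Finset.sum_congr rfl fun s _ => this l r s]
  simp only [Finset.sum_add_distrib]
  unfold cycSum
  refine congrArg₂ (· + ·) (Finset.sum_congr rfl fun l _ => Finset.sum_comm) ?_
  rw [Finset.sum_congr rfl fun l _ => Finset.sum_comm, Finset.sum_comm]

/-- If the second rectangle starts at the east side of the first, only the cyclic order in which the
two do not overlap contributes, by `not_empty_middle`. -/
lemma sum_share_middle (hz : z ≠ x) : ∑ l, ∑ r, ∑ s, pairTerm f x z l r r s =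
    cycSum (fun u v w => pairTerm f x z u v v w) := by
  classical
  unfold cycSum
  refine Finset.sum_congr rfl fun u _ => Finset.sum_congr rfl fun v _ =>
    Finset.sum_congr rfl fun w _ => ?_
  split_ifs with h
  · rfl
  by_cases h1 : u = v
  · subst h1; simp [pairTerm_eq_zero_left]
  by_cases h2 : v = w
  · subst h2; simp [pairTerm_eq_zero_right]
  by_cases h3 : u = w
  · subst h3; simp [pairTerm_eq_zero_of_eq f x z hz]
  exact pairTerm_eq_zero f x z (not_empty_middle ((cycIoo_or h1 h3 h2).resolve_left h))

lemma sum_share_outer (hz : z ≠ x) : ∑ l, ∑ r, ∑ s, pairTerm f x z l r s l =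
    cycSum (fun u v w => pairTerm f x z v w u v) := by
  classical
  unfold cycSum
  have : ∀ l r s : Fin n, pairTerm f x z l r s l =
      if CycIoo s r l then pairTerm f x z l r s l else 0 := by
    intro v w u
    split_ifs with h
    · rfl
    by_cases h1 : u = v
    · subst h1; simp [pairTerm_eq_zero_right]
    by_cases h2 : v = w
    · subst h2; simp [pairTerm_eq_zero_left]
    by_cases h3 : u = w
    · subst h3; simp [pairTerm_eq_zero_of_eq f x z hz]
    exact pairTerm_eq_zero f x z (not_empty_outer ((cycIoo_or h1 h3 h2).resolve_left h))
  rw [Finset.sum_congr rfl fun l _ => Finset.sum_congr rfl fun r _ =>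
    Finset.sum_congr rfl fun s _ => this l r s]
  rw [Finset.sum_congr rfl fun l _ => Finset.sum_comm, Finset.sum_comm]

/-- The pairs of empty rectangles between two different states cancel in pairs with the same
domain. -/
lemma sum_pairTerm_of_ne (hz : z ≠ x) : ∑ l, ∑ r, ∑ l', ∑ r', pairTerm f x z l r l' r' = 0 := by
  classical
  rw [Finset.sum_congr rfl fun l _ => Finset.sum_congr rfl fun r _ =>
    Finset.sum_congr rfl fun l' _ => Finset.sum_congr rfl fun r' _ =>
      pairTerm_split f x z hz l r l' r']
  simp only [Finset.sum_add_distrib]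
  rw [sum_pairTerm_disjoint]
  have e1 : ∀ l r l' : Fin n, (∑ r', if l' = l then pairTerm f x z l r l r' else 0) =
      if l' = l then ∑ r', pairTerm f x z l r l r' else 0 := by
    intro l r l'; split_ifs <;> simp
  have e2 : ∀ l r l' : Fin n, (∑ r', if l' = r then pairTerm f x z l r r r' else 0) =
      if l' = r then ∑ r', pairTerm f x z l r r r' else 0 := by
    intro l r l'; split_ifs <;> simp
  simp only [e1, e2, Finset.sum_ite_eq', Finset.mem_univ, if_true, zero_add]
  rw [sum_share_left f x z hz, sum_share_right f x z hz, sum_share_middle f x z hz,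
    sum_share_outer f x z hz]
  have hC : cycSum (fun u v w => pairTerm f x z u v v w) +
      cycSum (fun u v w => pairTerm f x z u w u v) +
      cycSum (fun u v w => pairTerm f x z v w u w) = 0 := by
    simp only [cycSum, ← Finset.sum_add_distrib]
    refine Finset.sum_eq_zero fun u _ => Finset.sum_eq_zero fun v _ =>
      Finset.sum_eq_zero fun w _ => ?_
    split_ifs with h
    · exact pairTerm_cancel_middle f x z h
    · simp
  have hB : cycSum (fun u v w => pairTerm f x z v w u v) +
      cycSum (fun u v w => pairTerm f x z u v u w) +
      cycSum (fun u v w => pairTerm f x z u w v w) = 0 := by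
    simp only [cycSum, ← Finset.sum_add_distrib]
    refine Finset.sum_eq_zero fun u _ => Finset.sum_eq_zero fun v _ =>
      Finset.sum_eq_zero fun w _ => ?_
    split_ifs with h
    · exact pairTerm_cancel_outer f x z h
    · simp
  linear_combination hC + hB

end

/-! ### Decompositions of annuli -/

lemma val_add_one_eq [NeZero n] (hn : 2 ≤ n) (l : Fin n) :
    (l + 1).val = if l.val + 1 = n then 0 else l.val + 1 := by
  have := l.isLt
  rw [Fin.val_add, Fin.val_one', Nat.mod_eq_of_lt (by omega : 1 < n)]
  split_ifs with h
  · rw [h, Nat.mod_self]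
  · exact Nat.mod_eq_of_lt (by omega)

lemma cycIco_succ_iff [NeZero n] (hn : 2 ≤ n) (l c : Fin n) : CycIco l (l + 1) c ↔ c = l := by
  have h := val_add_one_eq hn l
  have := l.isLt
  have := c.isLt
  rw [cycIco_iff, Fin.ext_iff, h]
  split_ifs <;> omega

lemma forall_not_cycIoo_iff [NeZero n] (hn : 2 ≤ n) {l r : Fin n} (hlr : l ≠ r) :
    (∀ c, ¬ CycIoo l r c) ↔ r = l + 1 := by
  have hs := val_add_one_eq hn l
  have := l.isLt
  have := r.isLt
  constructor
  · intro h
    have := h (l + 1)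
    simp only [cycIoo_iff, cycIco_iff, Fin.ne_iff_vne, Fin.ext_iff] at *
    split_ifs at hs <;> omega
  · rintro rfl c hc
    exact hc.1 ((cycIco_succ_iff hn l c).1 hc.2)

lemma cycIco_or {s t : Fin n} (h : s ≠ t) (r : Fin n) : CycIco s t r ↔ ¬ CycIco t s r := by
  simp only [cycIco_iff, Fin.ne_iff_vne] at *
  omega

lemma empty_column_iff [NeZero n] (hn : 2 ≤ n) (x : GridState n) {l r : Fin n} (h : l ≠ r) :
    (IsEmptyRegion x (l, r) ∧ IsEmptyRegion (x * Equiv.swap l r) (l, r)) ↔ r = l + 1 := by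
  rw [← forall_not_cycIoo_iff hn h]
  constructor
  · rintro ⟨h1, h2⟩ c hc
    obtain ⟨n1, -, n3⟩ := cycIoo_ne hc
    have a1 := h1 c hc
    have a2 := h2 c hc
    simp only [Equiv.Perm.mul_apply, Equiv.swap_apply_left, Equiv.swap_apply_right,
      Equiv.swap_apply_of_ne_of_ne n1.symm n3] at a1 a2
    rcases cycIoo_or (x.injective.ne n1) (x.injective.ne h) (x.injective.ne n3) with h5 | h5
    · exact a1 h5
    · exact a2 (cycIoo_rotate h5)
  · exact fun h => ⟨fun c hc => (h c hc).elim, fun c hc => (h c hc).elim⟩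

lemma empty_row_iff [NeZero n] (hn : 2 ≤ n) (x : GridState n) {l r : Fin n} (h : l ≠ r) :
    (IsEmptyRegion x (l, r) ∧ IsEmptyRegion (x * Equiv.swap l r) (r, l)) ↔ x r = x l + 1 := by
  rw [← forall_not_cycIoo_iff hn (x.injective.ne h)]
  constructor
  · rintro ⟨h1, h2⟩ k hk
    obtain ⟨c, rfl⟩ := x.surjective k
    obtain ⟨n1, -, n3⟩ := cycIoo_ne hk
    have m1 : l ≠ c := fun e => n1 (e ▸ rfl)
    have m3 : c ≠ r := fun e => n3 (e ▸ rfl)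
    have a1 := h1 c
    have a2 := h2 c
    simp only [Equiv.Perm.mul_apply, Equiv.swap_apply_left, Equiv.swap_apply_right,
      Equiv.swap_apply_of_ne_of_ne m1.symm m3] at a1 a2
    rcases cycIoo_or m1 h m3 with h5 | h5
    · exact a1 h5 hk
    · exact a2 (cycIoo_rotate h5) hk
  · refine fun h => ⟨fun c _ hc => (h _ hc).elim, fun c _ hc => ?_⟩
    simp only [Equiv.Perm.mul_apply, Equiv.swap_apply_left, Equiv.swap_apply_right] at hc
    exact h _ hc

/-- The domain of the vertical annulus consisting of column `c₀`. -/
def columnDom (c₀ : Fin n) : Fin n → Fin n → ℕ := fun c _ => if c = c₀ then 1 else 0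

/-- The domain of the horizontal annulus consisting of row `h₀`. -/
def rowDom (h₀ : Fin n) : Fin n → Fin n → ℕ := fun _ h => if h = h₀ then 1 else 0

lemma dom_column [NeZero n] (hn : 2 ≤ n) (x : GridState n) {l : Fin n} (h : l ≠ l + 1) :
    dom x (l, l + 1) + dom (x * Equiv.swap l (l + 1)) (l, l + 1) = columnDom l := by
  classical
  funext c k
  have h2 := cycIco_or (x.injective.ne h) k
  simp only [Pi.add_apply, columnDom]
  rw [dom_mk x l _ rfl rfl, dom_mk (x * Equiv.swap l (l + 1)) l (l + 1) (s := x (l + 1))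
    (t := x l) (by simp) (by simp)]
  simp only [cycIco_succ_iff hn, h2]
  by_cases c = l <;> by_cases CycIco (x (l + 1)) (x l) k <;> simp [*]

lemma dom_row [NeZero n] (hn : 2 ≤ n) (x : GridState n) {l r : Fin n} (h : l ≠ r)
    (hx : x r = x l + 1) :
    dom x (l, r) + dom (x * Equiv.swap l r) (r, l) = rowDom (x l) := by
  classical
  funext c k
  have h2 := cycIco_or h c
  simp only [Pi.add_apply, rowDom]
  rw [dom_mk x l r rfl hx, dom_mk (x * Equiv.swap l r) r l (s := x l) (t := x l + 1)
    (by simp) (by simp [hx])]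
  simp only [cycIco_succ_iff hn, h2]
  by_cases k = x l <;> by_cases CycIco r l c <;> simp [*]

variable (f : (Fin n → Fin n → ℕ) → ZMod 2) (x : GridState n)

lemma pairTerm_self_eq_zero {l r l' r' : Fin n}
    (h : ¬ (l' = l ∧ r' = r ∨ l' = r ∧ r' = l)) : pairTerm f x x l r l' r' = 0 := by
  refine if_neg ?_
  rintro ⟨⟨h1, h2⟩, -, h3⟩
  have h3 : Equiv.swap l r * Equiv.swap l' r' = 1 := by simpa using h3.symm
  have h4 : Equiv.swap l' r' = Equiv.swap l r := by
    have := congrArg (Equiv.swap l r * ·) h3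
    simpa [← mul_assoc] using this
  have h5 := congrArg (fun e : Equiv.Perm (Fin n) => e l') h4
  simp only [Equiv.swap_apply_left, Equiv.swap_apply_def] at h5
  split_ifs at h5 <;> simp_all

/-- The pairs of empty rectangles from a state to itself are the decompositions of the annuli of
width one. -/
lemma sum_pairTerm_self [NeZero n] (hn : 2 ≤ n) :
    ∑ l, ∑ r, ∑ l', ∑ r', pairTerm f x x l r l' r' =
      (∑ c, f (columnDom c)) + ∑ h, f (rowDom h) := by
  classical
  have hne : ∀ l : Fin n, l ≠ l + 1 := fun l e => by
    have := congrArg Fin.val e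
    rw [val_add_one_eq hn] at this
    have := l.isLt
    split_ifs at * <;> omega
  have key : ∀ l r : Fin n, ∑ l', ∑ r', pairTerm f x x l r l' r' =
      (if r = l + 1 then f (columnDom l) else 0) +
        (if x r = x l + 1 then f (rowDom (x l)) else 0) := by
    intro l r
    by_cases h : l = r
    · subst h
      have := hne l
      have := hne (x l)
      simp [pairTerm_eq_zero_left, *]
    have e : ∀ l' r', pairTerm f x x l r l' r' =
        (if l' = l then if r' = r then pairTerm f x x l r l r else 0 else 0) +
        (if l' = r then if r' = l then pairTerm f x x l r r l else 0 else 0) := by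
      intro l' r'
      by_cases h1 : l' = l ∧ r' = r
      · obtain ⟨rfl, rfl⟩ := h1
        simp [h]
      by_cases h2 : l' = r ∧ r' = l
      · obtain ⟨rfl, rfl⟩ := h2
        simp [Ne.symm h]
      rw [pairTerm_self_eq_zero f x (by tauto)]
      by_cases l' = l <;> by_cases l' = r <;> by_cases r' = l <;> by_cases r' = r <;> simp_all
    rw [Finset.sum_congr rfl fun l' _ => Finset.sum_congr rfl fun r' _ => e l' r']
    simp only [Finset.sum_add_distrib, Finset.sum_ite_irrel, Finset.sum_ite_eq',
      Finset.sum_const_zero, Finset.mem_univ, if_true]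
    congr 1
    · unfold pairTerm
      simp only [empty_column_iff hn x h]
      by_cases hr : r = l + 1
      · subst hr
        simp [h, dom_column hn x h]
      · simp [hr]
    · unfold pairTerm
      simp only [empty_row_iff hn x h]
      by_cases hr : x r = x l + 1
      · simp [h, Ne.symm h, dom_row hn x h hr, hr, Equiv.swap_comm r l]
      · simp [hr]
  rw [Finset.sum_congr rfl fun l _ => Finset.sum_congr rfl fun r _ => key l r]
  simp only [Finset.sum_add_distrib, Finset.sum_ite_eq', Finset.mem_univ, if_true]
  congr 1
  rw [← Equiv.sum_comp x fun h => f (rowDom h)]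
  refine Finset.sum_congr rfl fun l _ => ?_
  rw [Finset.sum_eq_single (x.symm (x l + 1))]
  · simp
  · intro b _ hb
    rw [if_neg]
    rintro e
    exact hb (by rw [← e, Equiv.symm_apply_apply])
  · simp

/-- The pairs of successive empty rectangles from `x` to `z`, weighted by a function of their
domain: everything cancels except for the annuli of width one. For the constant weight `1` this is
the computation that the differential of the fully blocked theory squares to zero. -/
theorem sum_pairTerm [NeZero n] (hn : 2 ≤ n) (z : GridState n) :
    ∑ l, ∑ r, ∑ l', ∑ r', pairTerm f x z l r l' r' =
      if z = x then (∑ c, f (columnDom c)) + ∑ h, f (rowDom h) else 0 := by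
  split_ifs with h
  · subst h
    exact sum_pairTerm_self f z hn
  · exact sum_pairTerm_of_ne f x z h

/-! ### Counts of rectangles, pentagons and hexagons -/

open Classical in
/-- The number modulo two of the rectangles from `x` to `y` that satisfy the predicate `Q`. -/
noncomputable def rectCount (Q : GridState n → Fin n × Fin n → Prop) (x y : GridState n) : ZMod 2 :=
  (((rect x y).filter (Q x)).card : ZMod 2)

section
variable (Q Q' : GridState n → Fin n × Fin n → Prop)

open Classical in
lemma rectCount_eq_sum (x y : GridState n) : rectCount Q x y =
    ∑ l, ∑ r, if (l ≠ r ∧ Q x (l, r)) ∧ y = x * Equiv.swap l r then 1 else 0 := by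
  rw [rectCount, rect, Finset.filter_filter, Finset.card_filter, Nat.cast_sum,
    Fintype.sum_prod_type]
  refine Finset.sum_congr rfl fun l _ => Finset.sum_congr rfl fun r _ => ?_
  rw [Nat.cast_ite, Nat.cast_one, Nat.cast_zero]
  exact if_congr (by tauto) rfl rfl

open Classical in
/-- The sum of a function over the pairs of successive empty rectangles from `x` to `z`. -/
noncomputable def pairSum (x z : GridState n) (g : Fin n → Fin n → Fin n → Fin n → ZMod 2) :
    ZMod 2 :=
  ∑ l, ∑ r, ∑ l', ∑ r', if (l ≠ r ∧ l' ≠ r') ∧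
      (IsEmptyRegion x (l, r) ∧ IsEmptyRegion (x * Equiv.swap l r) (l', r')) ∧
      z = x * (Equiv.swap l r * Equiv.swap l' r')
    then g l r l' r' else 0

lemma pairSum_add (x z : GridState n) (g g' : Fin n → Fin n → Fin n → Fin n → ZMod 2) :
    pairSum x z g + pairSum x z g' = pairSum x z fun l r l' r' => g l r l' r' + g' l r l' r' := by
  simp only [pairSum, ← Finset.sum_add_distrib]
  refine Finset.sum_congr rfl fun l _ => Finset.sum_congr rfl fun r _ =>
    Finset.sum_congr rfl fun l' _ => Finset.sum_congr rfl fun r' _ => ?_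
  split_ifs <;> simp

lemma pairSum_congr (x z : GridState n) {g g' : Fin n → Fin n → Fin n → Fin n → ZMod 2}
    (h : ∀ l r l' r', l ≠ r → l' ≠ r' → IsEmptyRegion x (l, r) →
      IsEmptyRegion (x * Equiv.swap l r) (l', r') → g l r l' r' = g' l r l' r') :
    pairSum x z g = pairSum x z g' := by
  refine Finset.sum_congr rfl fun l _ => Finset.sum_congr rfl fun r _ =>
    Finset.sum_congr rfl fun l' _ => Finset.sum_congr rfl fun r' _ => ?_
  split_ifs with hh
  · exact h l r l' r' hh.1.1 hh.1.2 hh.2.1.1 hh.2.1.2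
  · rfl

open Classical in
/-- The coefficients of a composite of two counts are sums over pairs of successive rectangles. -/
lemma sum_rectCount_mul (hQ : ∀ x p, Q x p → IsEmptyRegion x p)
    (hQ' : ∀ x p, Q' x p → IsEmptyRegion x p) (x z : GridState n) :
    ∑ y, rectCount Q x y * rectCount Q' y z =
      pairSum x z fun l r l' r' =>
        if Q x (l, r) ∧ Q' (x * Equiv.swap l r) (l', r') then 1 else 0 := by
  unfold pairSum
  simp only [rectCount_eq_sum Q, Finset.sum_mul]
  rw [Finset.sum_comm]
  refine Finset.sum_congr rfl fun l _ => ?_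
  rw [Finset.sum_comm]
  refine Finset.sum_congr rfl fun r _ => ?_
  rw [Finset.sum_eq_single (x * Equiv.swap l r)]
  · rw [rectCount_eq_sum, Finset.mul_sum]
    refine Finset.sum_congr rfl fun l' _ => ?_
    rw [Finset.mul_sum]
    refine Finset.sum_congr rfl fun r' _ => ?_
    rw [ite_mul, one_mul, zero_mul, ← ite_and, mul_assoc]
    rw [← ite_and]
    have := hQ x (l, r)
    have := hQ' (x * Equiv.swap l r) (l', r')
    exact if_congr (by tauto) rfl rfl
  · intro y _ hy
    rw [if_neg (fun h => hy h.2), zero_mul]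
  · simp

end

/-- A height `h` lies above the point in row `a` and below the point in row `b`. -/
def InArc (a b h : Fin n) : Prop := h ≠ a ∧ CycIcc a b h

lemma not_inArc_iff {a b : Fin n} (hab : a ≠ b) (h : Fin n) : ¬ InArc a b h ↔ InArc b a h := by
  unfold InArc
  simp only [cycIcc_iff, Fin.ne_iff_vne] at *
  omega

section
variable [NeZero n] (i a b : Fin n)

/-- The signed number of times that the eastern boundary of a domain crosses the point in row `a`
of the vertical circle `i + 1`, upwards minus downwards. -/
def crossing (i a : Fin n) (D : Fin n → Fin n → ℕ) : ℤ := D i a - D (i + 1) a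

/-- The condition that a rectangle has a side on the vertical circle `i + 1` which passes the
point in row `a`. -/
def IsPent (i a : Fin n) (x : GridState n) (p : Fin n × Fin n) : Prop :=
  ((p.1 = i + 1 ∨ p.2 = i + 1) ∧ CycIco (x p.1) (x p.2) a) ∧ IsEmptyRegion x p

/-- The condition that a rectangle becomes a hexagon when a bigon is cut off. -/
def IsHex (i a b : Fin n) (x : GridState n) (p : Fin n × Fin n) : Prop :=
  ((p.2 = i + 1 ∧ CycIco (x p.1) (x p.2) a ∧ CycIco (x p.1) a b) ∨
    (p.1 = i + 1 ∧ CycIco (x p.1) (x p.2) b ∧ CycIco (x p.1) b a)) ∧ IsEmptyRegion x p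

lemma cycIco_pred_iff (hn : 2 ≤ n) {l r : Fin n} (hl : l ≠ i + 1) (hr : r ≠ i + 1) :
    CycIco l r i ↔ CycIco l r (i + 1) := by
  have h := val_add_one_eq hn i
  have := i.isLt
  have := l.isLt
  have := r.isLt
  simp only [cycIco_iff, Fin.ne_iff_vne] at *
  split_ifs at h <;> omega

lemma cycIco_east (hn : 2 ≤ n) {l : Fin n} (hl : l ≠ i + 1) :
    CycIco l (i + 1) i ∧ ¬ CycIco l (i + 1) (i + 1) := by
  have h := val_add_one_eq hn i
  have := i.isLt
  have := l.isLt
  simp only [cycIco_iff, Fin.ne_iff_vne] at *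
  split_ifs at h <;> omega

lemma cycIco_west (hn : 2 ≤ n) {r : Fin n} (hr : r ≠ i + 1) :
    ¬ CycIco (i + 1) r i ∧ CycIco (i + 1) r (i + 1) := by
  have h := val_add_one_eq hn i
  have := i.isLt
  have := r.isLt
  simp only [cycIco_iff, Fin.ne_iff_vne] at *
  split_ifs at h <;> omega

open Classical in
/-- A rectangle passes the point in row `a` on circle `i + 1` if and only if that row is among its
rows and one of its vertical sides is on this circle. -/
lemma crossing_dom (hn : 2 ≤ n) (x : GridState n) {l r : Fin n} (h : l ≠ r) :
    crossing i a (dom x (l, r)) =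
      if CycIco (x l) (x r) a then (if r = i + 1 then 1 else 0) - (if l = i + 1 then 1 else 0)
      else 0 := by
  unfold crossing
  rw [dom_mk x l r rfl rfl, dom_mk x l r rfl rfl]
  by_cases ha : CycIco (x l) (x r) a
  · by_cases hr : r = i + 1
    · subst hr
      simp [ha, h, cycIco_east i hn h]
    · by_cases hl : l = i + 1
      · subst hl
        simp [ha, hr, cycIco_west i hn hr]
      · simp [ha, hl, hr, cycIco_pred_iff i hn hl hr]
  · simp [ha]

/-- The possible crossings of a rectangle with the points in the rows `a` and `b`, when the point
of its initial state on circle `i + 1` lies above `a` and below `b`. -/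
lemma crossing_cases (hn : 2 ≤ n) (x : GridState n) {l r : Fin n} (h : l ≠ r)
    (hx : InArc a b (x (i + 1))) (u v : ℤ) (hu : crossing i a (dom x (l, r)) = u)
    (hv : crossing i b (dom x (l, r)) = v) :
    (u = 0 ∧ v = 0 ∧ InArc a b ((x * Equiv.swap l r) (i + 1))) ∨
    (u = 1 ∧ v = 0 ∧ ¬ InArc a b ((x * Equiv.swap l r) (i + 1))) ∨
    (u = 1 ∧ v = 1 ∧ InArc a b ((x * Equiv.swap l r) (i + 1))) ∨
    (u = 0 ∧ v = -1 ∧ ¬ InArc a b ((x * Equiv.swap l r) (i + 1))) ∨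
    (u = -1 ∧ v = -1 ∧ InArc a b ((x * Equiv.swap l r) (i + 1))) := by
  subst hu hv
  have hx' := x.injective.ne h
  rw [crossing_dom i a hn x h, crossing_dom i b hn x h, Equiv.Perm.mul_apply]
  by_cases hr : r = i + 1
  · subst hr
    rw [Equiv.swap_apply_right]
    unfold InArc at *
    simp only [cycIco_iff, cycIcc_iff, Fin.ne_iff_vne, h, if_true, if_false] at *
    split_ifs <;> omega
  by_cases hl : l = i + 1
  · subst hl
    rw [Equiv.swap_apply_left]
    unfold InArc at *
    simp only [cycIco_iff, cycIcc_iff, Fin.ne_iff_vne, hr, if_true, if_false] at *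
    split_ifs <;> omega
  · rw [Equiv.swap_apply_of_ne_of_ne (Ne.symm hl) (Ne.symm hr)]
    simp [hl, hr, hx]

lemma isPent_iff (hn : 2 ≤ n) (x : GridState n) {l r : Fin n} (h : l ≠ r) :
    IsPent i a x (l, r) ↔ crossing i a (dom x (l, r)) ≠ 0 ∧ IsEmptyRegion x (l, r) := by
  rw [crossing_dom i a hn x h, IsPent]
  refine and_congr_left fun _ => ?_
  by_cases hr : r = i + 1
  · subst hr; simp [h]
  · by_cases hl : l = i + 1 <;> simp [hl, hr]

lemma isHex_iff (hn : 2 ≤ n) (x : GridState n) {l r : Fin n} (h : l ≠ r) :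
    IsHex i a b x (l, r) ↔ ((InArc a b (x (i + 1)) ∧ crossing i a (dom x (l, r)) = 1 ∧
        crossing i b (dom x (l, r)) = 1) ∨
      (InArc b a (x (i + 1)) ∧ crossing i a (dom x (l, r)) = -1 ∧
        crossing i b (dom x (l, r)) = -1)) ∧ IsEmptyRegion x (l, r) := by
  rw [crossing_dom i a hn x h, crossing_dom i b hn x h, IsHex]
  refine and_congr_left fun _ => ?_
  have hx' := x.injective.ne h
  by_cases hr : r = i + 1
  · subst hr
    simp only [h, if_true, if_false, true_and, false_and, or_false]
    unfold InArc
    simp only [cycIco_iff, cycIcc_iff, Fin.ne_iff_vne] at *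
    split_ifs <;> norm_num <;> omega
  by_cases hl : l = i + 1
  · subst hl
    simp only [hr, if_true, if_false, true_and, false_and, false_or]
    unfold InArc
    simp only [cycIco_iff, cycIcc_iff, Fin.ne_iff_vne] at *
    split_ifs <;> norm_num <;> omega
  · simp [hl, hr]

end

/-! ### The chain map and homotopy identities for counts -/

lemma sum_pairTerm_eq_pairSum (f : (Fin n → Fin n → ℕ) → ZMod 2) (x z : GridState n) :
    ∑ l, ∑ r, ∑ l', ∑ r', pairTerm f x z l r l' r' =
      pairSum x z fun l r l' r' => f (dom x (l, r) + dom (x * Equiv.swap l r) (l', r')) :=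
  rfl

section
variable [NeZero n] (i a b : Fin n)

lemma succ_ne_self (hn : 2 ≤ n) (i : Fin n) : i + 1 ≠ i := fun e => by
  have := congrArg Fin.val e
  rw [val_add_one_eq hn] at this
  have := i.isLt
  split_ifs at * <;> omega

lemma crossing_add (D E : Fin n → Fin n → ℕ) :
    crossing i a (D + E) = crossing i a D + crossing i a E := by
  simp only [crossing, Pi.add_apply, Nat.cast_add]
  ring

lemma crossing_rowDom (h : Fin n) : crossing i a (rowDom h) = 0 := by
  simp [crossing, rowDom]

lemma crossing_columnDom (c : Fin n) : crossing i a (columnDom c) =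
    (if c = i then 1 else 0) - (if c = i + 1 then 1 else 0) := by
  simp [crossing, columnDom, eq_comm]

/-- The maps that count empty rectangles and pentagons commute: the parity of the number of
crossings is a function of the domain. -/
theorem rectCount_pent_comm (hn : 2 ≤ n) (x z : GridState n) :
    ∑ y, rectCount IsEmptyRegion x y * rectCount (IsPent i a) y z +
      ∑ y, rectCount (IsPent i a) x y * rectCount IsEmptyRegion y z = 0 := by
  classical
  have key := sum_pairTerm (fun D => ((crossing i a D : ℤ) : ZMod 2)) x hn z
  have hsum : (∑ c, ((crossing i a (columnDom c) : ℤ) : ZMod 2)) +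
      ∑ h, ((crossing i a (rowDom h) : ℤ) : ZMod 2) = 0 := by
    simp [crossing_rowDom, crossing_columnDom, Finset.sum_sub_distrib]
  rw [hsum, ite_self, sum_pairTerm_eq_pairSum] at key
  rw [sum_rectCount_mul _ _ (fun _ _ h => h) (fun _ _ h => h.2),
    sum_rectCount_mul _ _ (fun _ _ h => h.2) (fun _ _ h => h), pairSum_add]
  refine Eq.trans ?_ key
  have hpar : ∀ (x : GridState n) (l r : Fin n), l ≠ r → IsEmptyRegion x (l, r) →
      (if IsPent i a x (l, r) then 1 else 0) = ((crossing i a (dom x (l, r)) : ℤ) : ZMod 2) := by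
    intro x l r h hE
    have n1 : ¬ (l = i + 1 ∧ r = i + 1) := fun e => h (e.1.trans e.2.symm)
    simp only [isPent_iff i a hn _ h, crossing_dom i a hn _ h, hE, and_true]
    split_ifs <;> simp_all
  refine pairSum_congr x z fun l r l' r' h h' hE hE' => ?_
  simp only [hE, hE', true_and, and_true]
  rw [hpar _ _ _ h hE, hpar _ _ _ h' hE', crossing_add, Int.cast_add, add_comm]

/-- The number modulo two of the passages from `b` to `a` along a path on circle `i + 1` that
crosses the points `a` and `b` altogether `m` times, upwards minus downwards, and that ends above
`a` and below `b`. -/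
def passage (m : ℤ) : ZMod 2 := if 2 ≤ m ∨ m ≤ -3 then 1 else 0

/-- The possible crossings of a rectangle in terms of the arc of circle `i + 1` that contains the
point of its initial state. -/
lemma crossing_dichotomy (hn : 2 ≤ n) (hab : a ≠ b) (x : GridState n) {l r : Fin n} (h : l ≠ r)
    (u v : ℤ) (hu : crossing i a (dom x (l, r)) = u) (hv : crossing i b (dom x (l, r)) = v) :
    (InArc a b (x (i + 1)) ∧ ¬ InArc b a (x (i + 1)) ∧
      (u = 0 ∧ v = 0 ∨ u = 1 ∧ v = 0 ∨ u = 1 ∧ v = 1 ∨ u = 0 ∧ v = -1 ∨ u = -1 ∧ v = -1)) ∨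
    (¬ InArc a b (x (i + 1)) ∧ InArc b a (x (i + 1)) ∧
      (u = 0 ∧ v = 0 ∨ u = 0 ∧ v = 1 ∨ u = 1 ∧ v = 1 ∨ u = -1 ∧ v = 0 ∨ u = -1 ∧ v = -1)) := by
  by_cases hx : InArc a b (x (i + 1))
  · refine Or.inl ⟨hx, (not_inArc_iff hab.symm _).2 hx, ?_⟩
    rcases crossing_cases i a b hn x h hx u v hu hv with c | c | c | c | c <;> simp [c.1, c.2.1]
  · have hx' := (not_inArc_iff hab _).1 hx
    refine Or.inr ⟨hx, hx', ?_⟩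
    rcases crossing_cases i b a hn x h hx' v u hv hu with c | c | c | c | c <;> simp [c.1, c.2.1]

/-- The hexagon maps are homotopies, on the level of counts. The boundaries of two successive
rectangles trace out a path on circle `i + 1`; one hexagon or two pentagons correspond to a passage
from `b` to `a`, whose number is an iterated integral along the path and therefore depends on the
end point and on the total displacement only. -/
theorem rectCount_hex (hn : 2 ≤ n) (hab : a ≠ b) (x z : GridState n) :
    ∑ y, rectCount (IsHex i a b) x y * rectCount IsEmptyRegion y z +
      ∑ y, rectCount IsEmptyRegion x y * rectCount (IsHex i a b) y z +
      ∑ y, rectCount (IsPent i a) x y * rectCount (IsPent i b) y z = if z = x then 1 else 0 := by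
  classical
  obtain ⟨ε, hε⟩ : ∃ ε : ℤ, (InArc a b (x (i + 1)) ∧ ε = 1) ∨ (InArc b a (x (i + 1)) ∧ ε = -1) := by
    by_cases h : InArc a b (x (i + 1))
    · exact ⟨1, by simp [h]⟩
    · exact ⟨-1, by simp [(not_inArc_iff hab _).1 h]⟩
  have key := sum_pairTerm (fun D => passage (ε * (crossing i a D + crossing i b D))) x hn z
  have hsum : (∑ c, passage (ε * (crossing i a (columnDom c) + crossing i b (columnDom c)))) +
      ∑ h, passage (ε * (crossing i a (rowDom h) + crossing i b (rowDom h))) = 1 := by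
    have hi := succ_ne_self hn i
    simp only [crossing_rowDom]
    rw [show (∑ _h : Fin n, passage (ε * (0 + 0))) = 0 by simp [passage], add_zero,
      ← Finset.sum_subset (Finset.subset_univ {i, i + 1})]
    · rw [Finset.sum_pair hi.symm]
      simp only [crossing_columnDom, if_true, hi, hi.symm, if_false]
      rcases hε with ⟨-, rfl⟩ | ⟨-, rfl⟩ <;> decide
    · intro c _ hc
      simp only [Finset.mem_insert, Finset.mem_singleton, not_or] at hc
      simp [crossing_columnDom, hc.1, hc.2, passage]
  rw [hsum, sum_pairTerm_eq_pairSum] at key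
  rw [sum_rectCount_mul _ _ (fun _ _ h => h.2) (fun _ _ h => h),
    sum_rectCount_mul _ _ (fun _ _ h => h) (fun _ _ h => h.2),
    sum_rectCount_mul _ _ (fun _ _ h => h.2) (fun _ _ h => h.2), pairSum_add, pairSum_add]
  refine Eq.trans ?_ key
  refine pairSum_congr x z fun l r l' r' h h' hE hE' => ?_
  simp only [isPent_iff i _ hn _ h, isPent_iff i _ hn _ h', isHex_iff i a b hn _ h,
    isHex_iff i a b hn _ h', hE, hE', true_and, and_true, crossing_add]
  generalize hu : crossing i a (dom x (l, r)) = u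
  generalize hv : crossing i b (dom x (l, r)) = v
  generalize hu' : crossing i a (dom (x * Equiv.swap l r) (l', r')) = u'
  generalize hv' : crossing i b (dom (x * Equiv.swap l r) (l', r')) = v'
  -- In each case both sides are numbers that depend on the four crossing numbers only.
  rcases hε with ⟨hx, rfl⟩ | ⟨hx, rfl⟩
  · have hx2 := (not_inArc_iff hab.symm _).2 hx
    rcases crossing_cases i a b hn x h hx u v hu hv with
      ⟨rfl, rfl, hy⟩ | ⟨rfl, rfl, hy⟩ | ⟨rfl, rfl, hy⟩ | ⟨rfl, rfl, hy⟩ | ⟨rfl, rfl, hy⟩ <;>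
    rcases crossing_dichotomy i a b hn hab _ h' u' v' hu' hv' with ⟨h1, h2, c⟩ | ⟨h1, h2, c⟩ <;>
    first
    | exact absurd hy (by assumption)
    | exact absurd (by assumption) hy
    | (rcases c with c | c | c | c | c <;>
        (simp only [hx, hx2, h1, h2, c.1, c.2]
         decide))
  · have hx2 := (not_inArc_iff hab _).2 hx
    rcases crossing_cases i b a hn x h hx v u hv hu with
      ⟨rfl, rfl, hy⟩ | ⟨rfl, rfl, hy⟩ | ⟨rfl, rfl, hy⟩ | ⟨rfl, rfl, hy⟩ | ⟨rfl, rfl, hy⟩ <;>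
    rcases crossing_dichotomy i a b hn hab _ h' u' v' hu' hv' with ⟨h1, h2, c⟩ | ⟨h1, h2, c⟩ <;>
    first
    | exact absurd hy (by assumption)
    | exact absurd (by assumption) hy
    | (rcases c with c | c | c | c | c <;>
        (simp only [hx, hx2, h1, h2, c.1, c.2]
         decide))

end

/-! ### The Maslov function in the plane -/

/-- The number of pairs of points of a state one of which is northeast of the other. -/
def noninversions (x : GridState n) : ℤ := ∑ c, ∑ d, if c < d ∧ x c < x d then 1 else 0

/-- The number of markings of `S` that are comparable to a point `(c, u)` of the plane with
respect to the northeast order. -/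
def comparableMarks (S : Equiv.Perm (Fin n)) (c u : Fin n) : ℤ :=
  ∑ d, ((if c ≤ d ∧ u ≤ S d then 1 else 0) + (if d < c ∧ S d < u then 1 else 0))

/-- The Maslov function as an integer. -/
def maslovInt (S : Equiv.Perm (Fin n)) (x : GridState n) : ℤ :=
  noninversions x - ∑ c, comparableMarks S c (x c) + noninversions S + 1

lemma pairCount_eq_sum (p q : Fin n → ℚ × ℚ) : (pairCount p q : ℝ) =
    ((∑ c, ∑ d, if (p c).1 < (q d).1 ∧ (p c).2 < (q d).2 then 1 else 0 : ℤ) : ℝ) := by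
  rw [pairCount, Finset.card_filter, Fintype.sum_prod_type]
  push_cast
  rfl

lemma maslovOf_eq_maslovInt (S : Equiv.Perm (Fin n)) (x : GridState n) :
    maslovOf S x = maslovInt S x := by
  have h1 : ∀ x : GridState n, symCount (statePoint x) (statePoint x) = noninversions x := by
    intro x
    rw [symCount, pairCount_eq_sum, add_self_div_two]
    simp [statePoint, noninversions]
  have h2 : symCount (markPoint S) (markPoint S) = noninversions S := by
    rw [symCount, pairCount_eq_sum, add_self_div_two]
    simp [markPoint, noninversions]
  have h3 : ∀ a b : Fin n, ((a.val : ℚ) < b.val + 1 / 2) ↔ a ≤ b := by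
    intro a b
    rw [Fin.le_def]
    constructor
    · intro h
      have : (a.val : ℚ) < ((b.val + 1 : ℕ) : ℚ) := by push_cast; linarith
      exact Nat.lt_succ_iff.1 (by exact_mod_cast this)
    · intro h
      have : (a.val : ℚ) ≤ b.val := by exact_mod_cast h
      linarith
  have h4 : ∀ a b : Fin n, ((a.val : ℚ) + 1 / 2 < b.val) ↔ a < b := by
    intro a b
    rw [Fin.lt_def]
    constructor
    · intro h
      have : (a.val : ℚ) < b.val := by linarith
      exact_mod_cast this
    · intro h
      have : ((a.val + 1 : ℕ) : ℚ) ≤ b.val := by exact_mod_cast h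
      push_cast at this
      linarith
  rw [maslovOf, h1, h2, symCount, pairCount_eq_sum, pairCount_eq_sum, maslovInt]
  simp only [statePoint, markPoint, h3, h4]
  rw [Finset.sum_comm (f := fun c d => if c < d ∧ S c < x d then (1 : ℤ) else 0)]
  simp only [comparableMarks, Finset.sum_add_distrib]
  push_cast
  ring

lemma sum_sub_swap (φ : Fin n → Fin n → ℤ) (x : GridState n) {l r : Fin n} (h : l ≠ r) :
    ∑ c, φ c ((x * Equiv.swap l r) c) - ∑ c, φ c (x c) =
      φ l (x r) + φ r (x l) - φ l (x l) - φ r (x r) := by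
  rw [← Finset.sum_sub_distrib, ← Finset.sum_subset (Finset.subset_univ {l, r})]
  · rw [Finset.sum_pair h]
    simp only [Equiv.Perm.mul_apply, Equiv.swap_apply_left, Equiv.swap_apply_right]
    ring
  · intro c _ hc
    simp only [Finset.mem_insert, Finset.mem_singleton, not_or] at hc
    rw [Equiv.Perm.mul_apply, Equiv.swap_apply_of_ne_of_ne hc.1 hc.2, sub_self]

section planar
variable (S : Equiv.Perm (Fin n)) (x : GridState n) {l r : Fin n}

lemma comparableMarks_swap (h : l < r) (hx : x l < x r) :
    ∑ c, comparableMarks S c ((x * Equiv.swap l r) c) - ∑ c, comparableMarks S c (x c) =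
      - 2 * ∑ d, if (x l ≤ S d ∧ S d < x r) ∧ l ≤ d ∧ d < r then 1 else 0 := by
  rw [sum_sub_swap _ _ h.ne]
  simp only [comparableMarks, ← Finset.sum_add_distrib, ← Finset.sum_sub_distrib, Finset.mul_sum]
  refine Finset.sum_congr rfl fun d _ => ?_
  simp only [Fin.lt_def, Fin.le_def] at *
  rcases lt_or_ge d.val l.val with h1 | h1 <;> rcases lt_or_ge d.val r.val with h2 | h2 <;>
    rcases lt_or_ge (S d).val (x l).val with h3 | h3 <;>
    rcases lt_or_ge (S d).val (x r).val with h4 | h4 <;>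
    omega

/-- Whether two points of the plane are comparable with respect to the northeast order. -/
def comparable (c u d v : Fin n) : ℤ :=
  (if c < d ∧ u < v then 1 else 0) + (if d < c ∧ v < u then 1 else 0)

lemma two_mul_noninversions (x : GridState n) :
    2 * noninversions x = ∑ c, ∑ d, comparable c (x c) d (x d) := by
  simp only [comparable, Finset.sum_add_distrib]
  rw [Finset.sum_comm (f := fun c d => if d < c ∧ x d < x c then (1 : ℤ) else 0), noninversions,
    two_mul]

lemma noninversions_swap (h : l < r) (hx : x l < x r) :
    noninversions (x * Equiv.swap l r) - noninversions x =
      - 1 - 2 * ∑ c, if (x l < x c ∧ x c < x r) ∧ l < c ∧ c < r then 1 else 0 := by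
  set y := x * Equiv.swap l r with hy
  have hsymm : ∀ c u d v : Fin n, comparable c u d v = comparable d v c u := fun c u d v =>
    add_comm _ _
  set Δ : Fin n → Fin n → ℤ := fun c u => comparable c u l (x r) + comparable c u r (x l) -
    comparable c u l (x l) - comparable c u r (x r) with hΔ
  have h1 : ∀ c u, ∑ d, comparable c u d (y d) - ∑ d, comparable c u d (x d) = Δ c u :=
    fun c u => sum_sub_swap (fun d v => comparable c u d v) x h.ne
  have h2 : ∑ c, ∑ d, comparable c (y c) d (y d) - ∑ c, ∑ d, comparable c (x c) d (x d) =
      ∑ c, (Δ c (y c) + Δ c (x c)) := by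
    simp only [← h1, Finset.sum_add_distrib, Finset.sum_sub_distrib]
    rw [Finset.sum_comm (f := fun c d => comparable c (x c) d (y d))]
    simp only [fun c d => hsymm d (x d) c (y c)]
    ring
  have h3 : ∀ c, Δ c (y c) + Δ c (x c) =
      - 4 * (if (x l < x c ∧ x c < x r) ∧ l < c ∧ c < r then 1 else 0)
        - (if c = l then 1 else 0) - (if c = r then 1 else 0) := by
    intro c
    by_cases c1 : c = l
    · subst c1
      simp [hy, hΔ, comparable, h, hx, h.ne, h.not_gt, hx.not_gt]
    by_cases c2 : c = r
    · subst c2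
      simp [hy, hΔ, comparable, h, hx, h.ne', h.not_gt, hx.not_gt]
    have e : y c = x c := by
      rw [hy, Equiv.Perm.mul_apply, Equiv.swap_apply_of_ne_of_ne c1 c2]
    have c3 := x.injective.ne c1
    have c4 := x.injective.ne c2
    rw [e]
    simp only [hΔ, comparable, c1, c2, if_false]
    simp only [Fin.lt_def, Fin.ne_iff_vne] at *
    rcases lt_or_gt_of_ne c1 with h1 | h1 <;> rcases lt_or_gt_of_ne c2 with h2 | h2 <;>
      rcases lt_or_gt_of_ne c3 with h3 | h3 <;> rcases lt_or_gt_of_ne c4 with h4 | h4 <;> omega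
  rw [← two_mul_noninversions, ← two_mul_noninversions] at h2
  simp only [h3, Finset.sum_sub_distrib, ← Finset.mul_sum, Finset.sum_ite_eq', Finset.mem_univ,
    if_true] at h2
  linarith

end planar

/-! ### The Maslov function on the torus -/

open Classical in
lemma markCount_eq_sum (S : Equiv.Perm (Fin n)) (region : Fin n → Fin n → Prop) :
    (markCount S region : ℤ) = ∑ d, if region d (S d) then 1 else 0 := by
  rw [markCount, Finset.card_filter]
  push_cast
  rfl

open Classical in
/-- The number of points of `x` in the interior of the rectangle `(l, r)`. -/
noncomputable def interiorCount (x : GridState n) (l r : Fin n) : ℤ :=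
  ∑ c, if CycIoo (x l) (x r) (x c) ∧ CycIoo l r c then 1 else 0

open Classical in
lemma sum_cycIco_eq (s t : Fin n) (h : s ≠ t) :
    ∑ c, (if CycIco s t c then (1 : ℤ) else 0) = ∑ c, (if CycIoo s t c then 1 else 0) + 1 := by
  have : ∀ c, (if CycIco s t c then (1 : ℤ) else 0) =
      (if CycIoo s t c then 1 else 0) + if c = s then 1 else 0 := by
    intro c
    have h1 : CycIco s t s := by
      simp only [cycIco_iff, Fin.ne_iff_vne] at *
      omega
    by_cases hc : c = s
    · subst hc; simp [h1, not_cycIoo_left]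
    · simp [cycIoo_iff, hc]
  simp [this, Finset.sum_add_distrib]

/-- The relative Maslov formula for the rectangle `(l, r)` starting at `x`. -/
def MaslovFormula (S : Equiv.Perm (Fin n)) (x : GridState n) (l r : Fin n) : Prop :=
  maslovInt S (x * Equiv.swap l r) - maslovInt S x =
    2 * markCount S (inRect x (l, r)) - 1 - 2 * interiorCount x l r

variable (S : Equiv.Perm (Fin n)) (x : GridState n) {l r : Fin n}

lemma maslovFormula_of_lt (h : l < r) (hx : x l < x r) : MaslovFormula S x l r := by
  have h1 := comparableMarks_swap S x h hx
  have h2 := noninversions_swap x h hx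
  have h3 : ∀ {s t : Fin n}, s < t → ∀ q, CycIco s t q ↔ s ≤ q ∧ q < t := by
    intro s t hst q
    rw [cycIco_iff]
    simp only [Fin.lt_def, Fin.le_def] at *
    omega
  have h4 : ∀ {s t : Fin n}, s < t → ∀ q, CycIoo s t q ↔ s < q ∧ q < t := by
    intro s t hst q
    rw [cycIoo_iff, h3 hst]
    simp only [Fin.lt_def, Fin.le_def, Fin.ne_iff_vne] at *
    omega
  rw [MaslovFormula, maslovInt, maslovInt, markCount_eq_sum, interiorCount]
  simp only [inRect, h3 h, h3 hx, h4 h, h4 hx]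
  linarith

lemma mul_swap_apply_of_ne {l r c : Fin n} (h1 : c ≠ l) (h2 : c ≠ r) :
    (x * Equiv.swap l r) c = x c := by
  rw [Equiv.Perm.mul_apply, Equiv.swap_apply_of_ne_of_ne h1 h2]

lemma mul_swap_apply_left (l r : Fin n) : (x * Equiv.swap l r) l = x r := by simp

lemma mul_swap_apply_right (l r : Fin n) : (x * Equiv.swap l r) r = x l := by simp

lemma cycIoo_compl {l r c : Fin n} (h : l ≠ r) (h1 : c ≠ l) (h2 : c ≠ r) :
    CycIoo r l c ↔ ¬ CycIoo l r c := by
  simp only [cycIoo_iff, cycIco_iff, Fin.ne_iff_vne] at *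
  omega

/-- The relative Maslov formula for a rectangle follows from that for the other rectangle in the
same horizontal annulus. -/
lemma maslovFormula_of_row_compl (h : l ≠ r)
    (hy : MaslovFormula S (x * Equiv.swap l r) r l) : MaslovFormula S x l r := by
  classical
  have hx := x.injective.ne h
  unfold MaslovFormula at *
  rw [mul_assoc, Equiv.swap_comm r l, Equiv.swap_mul_self, mul_one] at hy
  have hm : (markCount S (inRect x (l, r)) : ℤ) +
      markCount S (inRect (x * Equiv.swap l r) (r, l)) =
      ∑ d, if CycIco (x l) (x r) d then 1 else 0 := by
    rw [← Equiv.sum_comp S, markCount_eq_sum, markCount_eq_sum, ← Finset.sum_add_distrib]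
    refine Finset.sum_congr rfl fun d _ => ?_
    simp only [inRect, mul_swap_apply_left, mul_swap_apply_right, cycIco_or h d]
    by_cases CycIco (x l) (x r) (S d) <;> by_cases CycIco r l d <;> simp [*]
  have hk : interiorCount x l r + interiorCount (x * Equiv.swap l r) r l =
      ∑ d, if CycIoo (x l) (x r) d then 1 else 0 := by
    rw [← Equiv.sum_comp x, interiorCount, interiorCount, ← Finset.sum_add_distrib]
    refine Finset.sum_congr rfl fun c _ => ?_
    simp only [mul_swap_apply_left, mul_swap_apply_right]
    by_cases h1 : c = l
    · subst h1; simp [not_cycIoo_left, not_cycIoo_right]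
    by_cases h2 : c = r
    · subst h2; simp [not_cycIoo_left, not_cycIoo_right]
    rw [mul_swap_apply_of_ne x h1 h2]
    simp only [cycIoo_compl h h1 h2]
    by_cases CycIoo (x l) (x r) (x c) <;> by_cases CycIoo l r c <;> simp [*]
  rw [sum_cycIco_eq _ _ hx] at hm
  linarith

/-- The relative Maslov formula for a rectangle follows from that for the other rectangle in the
same vertical annulus. -/
lemma maslovFormula_of_column_compl (h : l ≠ r)
    (hy : MaslovFormula S (x * Equiv.swap l r) l r) : MaslovFormula S x l r := by
  classical
  have hx := x.injective.ne h
  unfold MaslovFormula at *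
  rw [mul_assoc, Equiv.swap_mul_self, mul_one] at hy
  have hm : (markCount S (inRect x (l, r)) : ℤ) +
      markCount S (inRect (x * Equiv.swap l r) (l, r)) =
      ∑ d, if CycIco l r d then 1 else 0 := by
    rw [markCount_eq_sum, markCount_eq_sum, ← Finset.sum_add_distrib]
    refine Finset.sum_congr rfl fun d _ => ?_
    simp only [inRect, mul_swap_apply_left, mul_swap_apply_right, cycIco_or hx (S d)]
    by_cases CycIco (x r) (x l) (S d) <;> by_cases CycIco l r d <;> simp [*]
  have hk : interiorCount x l r + interiorCount (x * Equiv.swap l r) l r =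
      ∑ d, if CycIoo l r d then 1 else 0 := by
    rw [interiorCount, interiorCount, ← Finset.sum_add_distrib]
    refine Finset.sum_congr rfl fun c _ => ?_
    simp only [mul_swap_apply_left, mul_swap_apply_right]
    by_cases h1 : c = l
    · subst h1; simp [not_cycIoo_left]
    by_cases h2 : c = r
    · subst h2; simp [not_cycIoo_right]
    rw [mul_swap_apply_of_ne x h1 h2]
    simp only [cycIoo_compl hx (x.injective.ne h1) (x.injective.ne h2)]
    by_cases CycIoo (x l) (x r) (x c) <;> by_cases CycIoo l r c <;> simp [*]
  rw [sum_cycIco_eq _ _ h] at hm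
  linarith

/-- The relative Maslov formula on the torus. -/
theorem maslovFormula (h : l ≠ r) : MaslovFormula S x l r := by
  have key : ∀ (x : GridState n) (l r : Fin n), l < r → MaslovFormula S x l r := by
    intro x l r hlr
    rcases lt_or_gt_of_ne (x.injective.ne hlr.ne) with hx | hx
    · exact maslovFormula_of_lt S x hlr hx
    · refine maslovFormula_of_column_compl S x hlr.ne (maslovFormula_of_lt S _ hlr ?_)
      rwa [mul_swap_apply_left, mul_swap_apply_right]
  rcases lt_or_gt_of_ne h with hlr | hlr
  · exact key x l r hlr
  · exact maslovFormula_of_row_compl S x h (key _ r l hlr)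

/-- The Maslov function of the southwest corners of the markings. -/
lemma maslovInt_self (S : Equiv.Perm (Fin n)) : maslovInt S S = 1 - n := by
  have : ∑ c, comparableMarks S c (S c) = 2 * noninversions S + n := by
    have e : ∀ c d : Fin n, (if c ≤ d ∧ S c ≤ S d then (1 : ℤ) else 0) =
        (if c < d ∧ S c < S d then 1 else 0) + if d = c then 1 else 0 := by
      intro c d
      by_cases h : d = c
      · subst h; simp
      · have h1 : c ≤ d ↔ c < d := (Ne.symm h).le_iff_lt
        have h2 : S c ≤ S d ↔ S c < S d := (S.injective.ne (Ne.symm h)).le_iff_lt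
        simp [h, h1, h2]
    simp only [comparableMarks, e, Finset.sum_add_distrib, Finset.sum_ite_eq', Finset.mem_univ,
      if_true]
    rw [Finset.sum_comm (f := fun c d => if d < c ∧ S d < S c then (1 : ℤ) else 0)]
    simp only [noninversions, Finset.sum_const, Finset.card_univ, Fintype.card_fin]
    simp
    ring
  rw [maslovInt, this]
  ring

/-- The Maslov function is natural: a bijection of states that is compatible with the relative
formula, and takes the southwest corners of the markings to the southwest corners, preserves it. -/
lemma maslovInt_congr (φ : GridState n → GridState n) {S T : Equiv.Perm (Fin n)} (hS : φ S = T)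
    (h : ∀ (x : GridState n) (l r : Fin n), l ≠ r →
      maslovInt T (φ (x * Equiv.swap l r)) - maslovInt T (φ x) =
        maslovInt S (x * Equiv.swap l r) - maslovInt S x) (x : GridState n) :
    maslovInt T (φ x) = maslovInt S x := by
  have : ∀ g : Equiv.Perm (Fin n), maslovInt T (φ (S * g)) = maslovInt S (S * g) := by
    intro g
    induction g using Equiv.Perm.swap_induction_on' with
    | one => rw [mul_one, hS, maslovInt_self, maslovInt_self]
    | mul_swap g l r hlr ih =>
      rw [← mul_assoc]
      linarith [h (S * g) l r hlr]
  simpa using this (S⁻¹ * x)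

/-! ### Markings in pentagons and hexagons -/

lemma interiorCount_eq_zero {x : GridState n} {l r : Fin n} (h : IsEmptyRegion x (l, r)) :
    interiorCount x l r = 0 := by
  classical
  exact Finset.sum_eq_zero fun c _ => if_neg fun hc => h c hc.2 hc.1

/-- The Maslov functions of the initial and the final state of an empty rectangle. -/
lemma maslovInt_rect (S : Equiv.Perm (Fin n)) {x : GridState n} {l r : Fin n} (h : l ≠ r)
    (hE : IsEmptyRegion x (l, r)) :
    maslovInt S (x * Equiv.swap l r) =
      maslovInt S x + 2 * markCount S (inRect x (l, r)) - 1 := by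
  have := maslovFormula S x h
  rw [MaslovFormula, interiorCount_eq_zero hE] at this
  linarith

lemma noninversions_swap_succ [NeZero n] (S : Equiv.Perm (Fin n)) {i : Fin n}
    (hi : i.val + 1 < n) (hS : S i < S (i + 1)) :
    noninversions (S * Equiv.swap i (i + 1)) = noninversions S - 1 := by
  have hv := val_add_one_eq (by omega) i
  rw [if_neg (by omega)] at hv
  have := noninversions_swap S (l := i) (r := i + 1) (by rw [Fin.lt_def]; omega) hS
  rw [Finset.sum_eq_zero] at this
  · linarith
  · intro c _
    refine if_neg ?_
    rintro ⟨-, h1, h2⟩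
    rw [Fin.lt_def] at *
    omega

open Classical in
/-- The effect on the Maslov function of interchanging the markings of two consecutive columns. -/
lemma maslovInt_swap_marks [NeZero n] (S : Equiv.Perm (Fin n)) {i : Fin n} (hi : i.val + 1 < n)
    (y : GridState n) :
    maslovInt (S * Equiv.swap i (i + 1)) y =
      maslovInt S y + 2 * (if InArc (S i) (S (i + 1)) (y (i + 1)) then 1 else 0) - 1 := by
  have hv := val_add_one_eq (by omega) i
  rw [if_neg (by omega)] at hv
  have hne : i ≠ i + 1 := fun e => by have := congrArg Fin.val e; omega
  have hS := S.injective.ne hne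
  have h1 : noninversions (S * Equiv.swap i (i + 1)) = noninversions S +
      if S i < S (i + 1) then -1 else 1 := by
    split_ifs with h
    · rw [noninversions_swap_succ S hi h]
      ring
    · have := noninversions_swap_succ (S * Equiv.swap i (i + 1)) hi
        (by simpa using lt_of_le_of_ne (not_lt.1 h) hS.symm)
      rw [mul_assoc, Equiv.swap_mul_self, mul_one] at this
      linarith
  have h2 : ∑ c, comparableMarks (S * Equiv.swap i (i + 1)) c (y c) -
      ∑ c, comparableMarks S c (y c) =
      ∑ c, if c = i + 1 then ((if S (i + 1) < y (i + 1) then 1 else 0) +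
        (if y (i + 1) ≤ S i then 1 else 0) - (if S i < y (i + 1) then 1 else 0) -
        (if y (i + 1) ≤ S (i + 1) then 1 else 0) : ℤ) else 0 := by
    rw [← Finset.sum_sub_distrib]
    refine Finset.sum_congr rfl fun c _ => ?_
    rw [comparableMarks, comparableMarks, sum_sub_swap (fun d v =>
      (if c ≤ d ∧ y c ≤ v then (1 : ℤ) else 0) + (if d < c ∧ v < y c then 1 else 0)) S hne]
    by_cases hc : c = i + 1
    · subst hc
      have a1 : ¬ i + 1 ≤ i := by rw [Fin.le_def]; omega
      have a2 : i < i + 1 := by rw [Fin.lt_def]; omega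
      simp [a1, a2]
    · have a1 : c ≤ i + 1 ↔ c ≤ i := by
        rw [Fin.ext_iff] at hc
        rw [Fin.le_def, Fin.le_def]
        omega
      have a2 : i + 1 < c ↔ i < c := by
        rw [Fin.ext_iff] at hc
        rw [Fin.lt_def, Fin.lt_def]
        omega
      simp only [hc, a1, a2, if_false]
      ring
  rw [Finset.sum_ite_eq', if_pos (Finset.mem_univ _)] at h2
  rw [maslovInt, maslovInt, h1]
  have h3 : (if S i < S (i + 1) then (-1 : ℤ) else 1) -
      ((if S (i + 1) < y (i + 1) then 1 else 0) +
        (if y (i + 1) ≤ S i then 1 else 0) - (if S i < y (i + 1) then 1 else 0) -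
        (if y (i + 1) ≤ S (i + 1) then 1 else 0) : ℤ) =
      2 * (if InArc (S i) (S (i + 1)) (y (i + 1)) then 1 else 0) - 1 := by
    unfold InArc
    simp only [cycIcc_iff, Fin.lt_def, Fin.le_def, Fin.ne_iff_vne] at *
    split_ifs <;> omega
  linarith

/-- The position of the markings `s` and `s'` of the two columns relative to the bottom `B` of a
pentagon with its east side on circle `i + 1`. -/
lemma pentagon_arcs_east {a b s s' B T : Fin n} (hs : s ≠ s') (hE : CycIcc a b s')
    (hW : CycIcc b a s) (ha : CycIco B T a) :
    ((CycIco B a s ∨ s = a) → CycIco B T s) ∧ (CycIco B a s' → CycIco B T s') ∧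
    (((CycIco B a s ∨ s = a) ∧ CycIco B a s' ∧ InArc s s' B) ∨
      ((CycIco B a s ∨ s = a) ∧ ¬ CycIco B a s' ∧ ¬ InArc s s' B) ∨
      (¬ (CycIco B a s ∨ s = a) ∧ ¬ CycIco B a s' ∧ InArc s s' B)) := by
  unfold InArc
  simp only [cycIco_iff, cycIcc_iff, Fin.ne_iff_vne, Fin.ext_iff] at *
  refine ⟨by omega, by omega, ?_⟩
  omega

/-- The position of the markings `s` and `s'` of the two columns relative to the top `T` of a
pentagon with its west side on circle `i + 1`. -/
lemma pentagon_arcs_west {a b s s' B T : Fin n} (hs : s ≠ s') (hE : CycIcc a b s')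
    (hW : CycIcc b a s) (ha : CycIco B T a) :
    (CycIco B T s' ∧ ¬ CycIco B a s' ∧ CycIco B T s ∧ ¬ (CycIco B a s ∨ s = a) ∧
        InArc s s' T) ∨
      (CycIco B T s' ∧ ¬ CycIco B a s' ∧ ¬ (CycIco B T s ∧ ¬ (CycIco B a s ∨ s = a)) ∧
        ¬ InArc s s' T) ∨
      ((CycIco B T s' ↔ CycIco B a s') ∧ ¬ (CycIco B T s ∧ ¬ (CycIco B a s ∨ s = a)) ∧
        InArc s s' T) := by
  unfold InArc
  simp only [cycIco_iff, cycIcc_iff, Fin.ne_iff_vne, Fin.ext_iff] at *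
  omega

section
variable [NeZero n] {S : Equiv.Perm (Fin n)} {i a b : Fin n} {x : GridState n} {l r : Fin n}

open Classical in
/-- The number of markings in a pentagon compared with the corresponding rectangle. -/
lemma markCount_inPent (hn : 2 ≤ n) (hE : CycIcc a b (S (i + 1)))
    (hW : CycIcc b a (S i)) (h : l ≠ r) (hi : l = i + 1 ∨ r = i + 1)
    (ha : CycIco (x l) (x r) a) :
    (markCount S (inPent i a x (l, r)) : ℤ) = markCount S (inRect x (l, r)) - 1 +
      if InArc (S i) (S (i + 1)) ((x * Equiv.swap l r) (i + 1)) then 1 else 0 := by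
  have hne := (succ_ne_self hn i).symm
  have hS := S.injective.ne hne
  have hx := x.injective.ne h
  have hsum : (markCount S (inPent i a x (l, r)) : ℤ) - markCount S (inRect x (l, r)) =
      ∑ d ∈ {i, i + 1}, ((if inPent i a x (l, r) d (S d) then 1 else 0) -
        (if inRect x (l, r) d (S d) then 1 else 0)) := by
    rw [markCount_eq_sum, markCount_eq_sum, ← Finset.sum_sub_distrib]
    refine (Finset.sum_subset (Finset.subset_univ _) fun d _ hd => ?_).symm
    simp only [Finset.mem_insert, Finset.mem_singleton, not_or] at hd
    have : inPent i a x (l, r) d (S d) ↔ inRect x (l, r) d (S d) := by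
      simp only [inPent, inRect, Equiv.swap_apply_of_ne_of_ne hd.1 hd.2]
      tauto
    simp [this]
  rw [Finset.sum_pair hne] at hsum
  rw [← sub_eq_iff_eq_add'] at hsum
  suffices H : ((if inPent i a x (l, r) i (S i) then (1 : ℤ) else 0) -
        (if inRect x (l, r) i (S i) then 1 else 0)) +
      ((if inPent i a x (l, r) (i + 1) (S (i + 1)) then 1 else 0) -
        (if inRect x (l, r) (i + 1) (S (i + 1)) then 1 else 0)) =
      (if InArc (S i) (S (i + 1)) ((x * Equiv.swap l r) (i + 1)) then 1 else 0) - 1 by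
    linarith
  rcases hi with rfl | rfl
  · have w := cycIco_west i hn h.symm
    simp only [inPent, inRect, IsBelowCrossing, mul_swap_apply_left, Equiv.swap_apply_left,
      Equiv.swap_apply_right, w, h.symm, hne.symm, true_and, and_true, false_and, and_false,
      false_or, or_false, if_false]
    rcases pentagon_arcs_west hS hE hW ha with ⟨c1, c2, c3, c4, c5⟩ | ⟨c1, c2, c3, c4⟩ |
        ⟨c1, c2, c3⟩
    · simp [c1, c2, c3, c4, c5]
    · rw [if_neg c3]
      simp [c1, c2, c4]
    · rw [if_neg c2]
      simp [c1, c3]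
  · have w := cycIco_east i hn h
    simp only [inPent, inRect, IsBelowCrossing, mul_swap_apply_right, Equiv.swap_apply_left,
      Equiv.swap_apply_right, w, h, hne.symm, true_and, and_true, false_and, and_false,
      false_or, or_false, if_false]
    obtain ⟨c1, c2, c⟩ := pentagon_arcs_east hS hE hW ha
    rcases c with ⟨d1, d2, d3⟩ | ⟨d1, d2, d3⟩ | ⟨d1, d2, d3⟩
    · simp [d1, d2, d3, c1 d1, c2 d2]
    · simp [d1, d2, d3, c1 d1]
    · simp [d1, d2, d3]

/-- A hexagon contains one marking less than the corresponding rectangle. -/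
lemma markCount_inHex (hn : 2 ≤ n) (hE : CycIcc a b (S (i + 1)))
    (hW : CycIcc b a (S i)) (h : l ≠ r)
    (hh : (r = i + 1 ∧ CycIco (x l) (x r) a ∧ CycIco (x l) a b) ∨
      (l = i + 1 ∧ CycIco (x l) (x r) b ∧ CycIco (x l) b a)) :
    (markCount S (inHex i x (l, r)) : ℤ) = markCount S (inRect x (l, r)) - 1 := by
  classical
  have key : ∀ c : Fin n, inRect x (l, r) c (S c) →
      (∀ d, inHex i x (l, r) d (S d) ↔ inRect x (l, r) d (S d) ∧ d ≠ c) →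
      (markCount S (inHex i x (l, r)) : ℤ) = markCount S (inRect x (l, r)) - 1 := by
    intro c hc hd
    have : ∀ d, (if inHex i x (l, r) d (S d) then (1 : ℤ) else 0) =
        (if inRect x (l, r) d (S d) then 1 else 0) - if d = c then 1 else 0 := by
      intro d
      by_cases h1 : d = c
      · subst h1; simp [hd, hc]
      · simp [hd, h1]
    rw [markCount_eq_sum, markCount_eq_sum]
    simp [this, Finset.sum_sub_distrib]
  have hx := x.injective.ne h
  rcases hh with ⟨rfl, h1, h2⟩ | ⟨rfl, h1, h2⟩
  · refine key i ⟨?_, (cycIco_east i hn h).1⟩ fun d => ?_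
    · simp only [cycIco_iff, cycIcc_iff, Fin.ne_iff_vne] at *
      omega
    · simp only [inHex, h, false_imp_iff, true_imp_iff, and_true]
  · refine key (i + 1) ⟨?_, (cycIco_west i hn h.symm).2⟩ fun d => ?_
    · simp only [cycIco_iff, cycIcc_iff, Fin.ne_iff_vne] at *
      omega
    · simp only [inHex, h.symm, false_imp_iff, true_imp_iff, true_and]

end

/-! ### Coefficients as real powers -/

/-- The embedding of `Rt t` into the Hahn series with real exponents, where every power of `U` is
invertible. -/
noncomputable def toRealSeries (t : ℝ≥0) : Rt t →+* HahnSeries ℝ (ZMod 2) :=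
  (HahnSeries.embDomainRingHom NNReal.toRealHom.toAddMonoidHom NNReal.coe_injective
    (fun _ _ => NNReal.coe_le_coe)).comp (subringRt t).subtype

lemma toRealSeries_injective (t : ℝ≥0) : Function.Injective (toRealSeries t) :=
  HahnSeries.embDomain_injective.comp Subtype.coe_injective

/-- The power of `U` with a real exponent. -/
noncomputable def realPow (α : ℝ) : HahnSeries ℝ (ZMod 2) := HahnSeries.single α 1

lemma realPow_mul (α β : ℝ) : realPow α * realPow β = realPow (α + β) := by
  simp [realPow]

lemma realPow_zero : realPow 0 = 1 := rfl

lemma toRealSeries_monomial (t α : ℝ≥0) (h : U α ∈ subringRt t) :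
    toRealSeries t (monomial t α h) = realPow α :=
  HahnSeries.embDomain_single

lemma monomial_mul (t α β : ℝ≥0) (h : U α ∈ subringRt t) (h' : U β ∈ subringRt t) :
    monomial t α h * monomial t β h' = monomial t (α + β) (U_mul α β ▸ mul_mem h h') :=
  Subtype.ext (U_mul α β)

/-! ### Maps that count regions -/

section
variable (t : ℝ≥0) (Q : GridState n → Fin n × Fin n → Prop) (w : GridState n → Fin n × Fin n → Rt t)

open Classical in
/-- The coefficient from `x` to `y` of the map that counts the rectangles with property `Q` with
weight `w`. -/
noncomputable def regionCoeff (x y : GridState n) : Rt t := ∑ p ∈ (rect x y).filter (Q x), w x p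

/-- The map that counts the rectangles with property `Q` with weight `w`. -/
noncomputable def regionMap : (GridState n → Rt t) →ₗ[Rt t] (GridState n → Rt t) :=
  Fintype.linearCombination (Rt t) fun x => ∑ y : GridState n, Pi.single y (regionCoeff t Q w x y)

lemma regionMap_single (x : GridState n) (c : Rt t) (y : GridState n) :
    regionMap t Q w (Pi.single x c) y = c * regionCoeff t Q w x y := by
  rw [regionMap, Fintype.linearCombination_apply_single]
  simp [Finset.sum_apply, Pi.single_apply]

lemma regionMap_apply (v : GridState n → Rt t) (z : GridState n) :
    regionMap t Q w v z = ∑ y, v y * regionCoeff t Q w y z := by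
  rw [regionMap, Fintype.linearCombination_apply]
  simp [Finset.sum_apply, Pi.single_apply]

/-- The map that counts rectangles with property `Q` with weight `w` is homogeneous of degree `e`
between the complexes of `G` and `G'`. -/
def HasDegree (G G' : GridDiagram n) (e : ℝ) : Prop :=
  ∀ (x : GridState n) (l r : Fin n), l ≠ r → Q x (l, r) →
    ∃ (α : ℝ≥0) (hα : U α ∈ subringRt t), w x (l, r) = monomial t α hα ∧
      gr t G' α (x * Equiv.swap l r) = gr t G 0 x + e

variable {t Q w} {G G' G'' : GridDiagram n} {e e' : ℝ}

lemma mem_rect {x y : GridState n} {p : Fin n × Fin n} :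
    p ∈ rect x y ↔ p.1 ≠ p.2 ∧ y = x * Equiv.swap p.1 p.2 := by
  simp [rect]

/-- A homogeneous coefficient is a number modulo two times a power of `U` whose exponent is
determined by the gradings. -/
lemma toRealSeries_regionCoeff (h : HasDegree t Q w G G' e) (x y : GridState n) :
    toRealSeries t (regionCoeff t Q w x y) =
      HahnSeries.C (rectCount Q x y) * realPow (gr t G' 0 y - gr t G 0 x - e) := by
  classical
  rw [regionCoeff, map_sum, rectCount, map_natCast, ← nsmul_eq_mul]
  refine (Finset.sum_eq_card_nsmul fun p hp => ?_).trans (by congr)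
  obtain ⟨hp, hQ⟩ := Finset.mem_filter.1 hp
  obtain ⟨hne, rfl⟩ := mem_rect.1 hp
  obtain ⟨α, hα, hw, hgr⟩ := h x p.1 p.2 hne hQ
  rw [hw, toRealSeries_monomial]
  congr 1
  simp only [gr, NNReal.coe_zero] at *
  linarith

/-- The coefficients of a composite of homogeneous maps. -/
lemma toRealSeries_comp {Q' : GridState n → Fin n × Fin n → Prop}
    {w' : GridState n → Fin n × Fin n → Rt t} (h : HasDegree t Q w G G' e)
    (h' : HasDegree t Q' w' G' G'' e') (x z : GridState n) :
    toRealSeries t (regionMap t Q' w' (regionMap t Q w (Pi.single x 1)) z) =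
      HahnSeries.C (∑ y, rectCount Q x y * rectCount Q' y z) *
        realPow (gr t G'' 0 z - gr t G 0 x - (e + e')) := by
  rw [regionMap_apply, map_sum, map_sum, Finset.sum_mul]
  refine Finset.sum_congr rfl fun y _ => ?_
  rw [regionMap_single, one_mul, map_mul, toRealSeries_regionCoeff h,
    toRealSeries_regionCoeff h', map_mul, mul_mul_mul_comm, realPow_mul]
  congr 2
  ring

lemma mem_tGCdeg_of_hasDegree (h : HasDegree t Q w G G' e) {d : ℝ} {z : tGC t G}
    (hz : z ∈ tGCdeg t G d) : (regionMap t Q w z : tGC t G') ∈ tGCdeg t G' (d + e) := by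
  classical
  induction hz using AddSubgroup.closure_induction with
  | zero => rw [map_zero]; exact zero_mem _
  | add a b _ _ ha hb => rw [map_add]; exact add_mem ha hb
  | neg a _ ha => rw [map_neg]; exact neg_mem ha
  | mem m hm =>
    obtain ⟨x, α, hα, hd, rfl⟩ := hm
    have e1 : regionMap t Q w (Pi.single x (monomial t α hα)) =
        ∑ y, Pi.single y (monomial t α hα * regionCoeff t Q w x y) := by
      funext y
      rw [regionMap_single]
      simp [Finset.sum_apply, Pi.single_apply]
    rw [e1]
    refine sum_mem fun y _ => ?_
    rw [regionCoeff, Finset.mul_sum, ← LinearMap.single_apply (R := Rt t) (φ := fun _ => Rt t),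
      map_sum]
    refine sum_mem fun p hp => ?_
    obtain ⟨hp, hQ⟩ := Finset.mem_filter.1 hp
    obtain ⟨hne, rfl⟩ := mem_rect.1 hp
    obtain ⟨β, hβ, hw, hgr⟩ := h x p.1 p.2 hne hQ
    refine AddSubgroup.subset_closure ⟨x * Equiv.swap p.1 p.2, α + β,
      U_mul α β ▸ mul_mem hα hβ, ?_, ?_⟩
    · simp only [gr, NNReal.coe_zero, NNReal.coe_add] at *
      linarith
    · rw [hw, monomial_mul]
      rfl

end

/-! ### Degrees of the maps -/

section
variable {t : ℝ≥0} {G G' : GridDiagram n}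

lemma gr_of_maslovInt (ht : t ≤ 2) {x y : GridState n} {region : Fin n → Fin n → Prop} {e : ℤ}
    (hO : maslovInt G'.O y = maslovInt G.O x + 2 * markCount G.O region + e)
    (hX : maslovInt G'.X y = maslovInt G.X x + 2 * markCount G.X region + e) :
    ∃ (α : ℝ≥0) (hα : U α ∈ subringRt t), regionWeight t G region = monomial t α hα ∧
      gr t G' α y = gr t G 0 x + e := by
  refine ⟨_, U_mem t _ _, rfl, ?_⟩
  have hO' : (maslovInt G'.O y : ℝ) = maslovInt G.O x + 2 * markCount G.O region + e := by
    exact_mod_cast hO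
  have hX' : (maslovInt G'.X y : ℝ) = maslovInt G.X x + 2 * markCount G.X region + e := by
    exact_mod_cast hX
  simp only [gr, maslov, alexander, maslovOf_eq_maslovInt, hO', hX', NNReal.coe_add,
    NNReal.coe_mul, NNReal.coe_sub ht, NNReal.coe_natCast, NNReal.coe_zero, NNReal.coe_ofNat]
  ring

end

/-! ### Properties of the pentagon and hexagon maps -/

section
variable {t : ℝ≥0} {G G' : GridDiagram n}

lemma differential_eq (t : ℝ≥0) (G : GridDiagram n) : differential t G =
    regionMap t IsEmptyRegion (fun x p => regionWeight t G (inRect x p)) :=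
  rfl

lemma hasDegree_differential (ht : t ≤ 2) (G : GridDiagram n) :
    HasDegree t IsEmptyRegion (fun x p => regionWeight t G (inRect x p)) G G (-1) := by
  intro x l r h hE
  have := gr_of_maslovInt (G := G) (G' := G) ht (e := -1) (maslovInt_rect G.O h hE)
    (maslovInt_rect G.X h hE)
  simpa using this

/-- Two linear maps into the complex agree if their coefficients do. -/
lemma linearMap_ext {t : ℝ≥0} {f g : (GridState n → Rt t) →ₗ[Rt t] (GridState n → Rt t)}
    (h : ∀ x z, toRealSeries t (f (Pi.single x 1) z) = toRealSeries t (g (Pi.single x 1) z)) :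
    f = g := by
  refine LinearMap.pi_ext' fun x => LinearMap.ext_ring (funext fun z => ?_)
  exact toRealSeries_injective t (h x z)

variable [NeZero n] {i a b : Fin n}

lemma pentagonMap_eq (t : ℝ≥0) (G G' : GridDiagram n) (i a : Fin n) : pentagonMap t G G' i a =
    regionMap t (IsPent i a) (fun x p => regionWeight t G (inPent i a x p)) := by
  classical
  unfold pentagonMap regionMap regionCoeff
  refine congrArg _ (funext fun x => Finset.sum_congr rfl fun y _ =>
    congrArg _ (Finset.sum_congr (Finset.ext fun p => ?_) fun _ _ => rfl))
  simp only [pent, IsPent, Finset.mem_filter]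
  tauto

lemma hexagonMap_eq (t : ℝ≥0) (G : GridDiagram n) (i a b : Fin n) : hexagonMap t G i a b =
    regionMap t (IsHex i a b) (fun x p => regionWeight t G (inHex i x p)) := by
  classical
  unfold hexagonMap regionMap regionCoeff
  refine congrArg _ (funext fun x => Finset.sum_congr rfl fun y _ =>
    congrArg _ (Finset.sum_congr (Finset.ext fun p => ?_) fun _ _ => rfl))
  simp only [hex, IsHex, Finset.mem_filter]
  tauto

lemma maslovInt_pent {S : Equiv.Perm (Fin n)} (hi : i.val + 1 < n) (hE : CycIcc a b (S (i + 1)))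
    (hW : CycIcc b a (S i)) {x : GridState n} {l r : Fin n} (h : l ≠ r)
    (hp : IsPent i a x (l, r)) :
    maslovInt (S * Equiv.swap i (i + 1)) (x * Equiv.swap l r) =
      maslovInt S x + 2 * markCount S (inPent i a x (l, r)) + 0 := by
  rw [maslovInt_swap_marks S hi, maslovInt_rect S h hp.2,
    markCount_inPent (by omega) hE hW h hp.1.1 hp.1.2]
  ring

lemma hasDegree_pentagonMap (ht : t ≤ 2) (hi : i.val + 1 < n)
    (hG : G' = G.swapColumns i (i + 1)) (hd : IsDrawing G i a b) :
    HasDegree t (IsPent i a) (fun x p => regionWeight t G (inPent i a x p)) G G' 0 := by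
  subst hG
  intro x l r h hp
  have := gr_of_maslovInt (G := G) (G' := G.swapColumns i (i + 1)) ht (e := 0)
    (maslovInt_pent hi hd.2.1.2 hd.2.2.2 h hp) (maslovInt_pent hi hd.2.1.1 hd.2.2.1 h hp)
  simpa using this

lemma maslovInt_hex {S : Equiv.Perm (Fin n)} (hn : 2 ≤ n) (hE : CycIcc a b (S (i + 1)))
    (hW : CycIcc b a (S i)) {x : GridState n} {l r : Fin n} (h : l ≠ r)
    (hp : IsHex i a b x (l, r)) :
    maslovInt S (x * Equiv.swap l r) = maslovInt S x + 2 * markCount S (inHex i x (l, r)) + 1 := by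
  rw [maslovInt_rect S h hp.2, markCount_inHex hn hE hW h hp.1]
  ring

lemma hasDegree_hexagonMap (ht : t ≤ 2) (hn : 2 ≤ n) (hd : IsDrawing G i a b) :
    HasDegree t (IsHex i a b) (fun x p => regionWeight t G (inHex i x p)) G G 1 := by
  intro x l r h hp
  have := gr_of_maslovInt (G := G) (G' := G) ht (e := 1)
    (maslovInt_hex hn hd.2.1.2 hd.2.2.2 h hp) (maslovInt_hex hn hd.2.1.1 hd.2.2.1 h hp)
  simpa using this

lemma pentagonMap_mem_deg (ht : t ≤ 2) (hi : i.val + 1 < n)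
    (hG : G' = G.swapColumns i (i + 1)) (hd : IsDrawing G i a b) {d : ℝ} {z : tGC t G}
    (hz : z ∈ tGCdeg t G d) : pentagonMap t G G' i a z ∈ tGCdeg t G' d := by
  have := mem_tGCdeg_of_hasDegree (hasDegree_pentagonMap ht hi hG hd) hz
  rwa [add_zero, ← pentagonMap_eq] at this

lemma hexagonMap_mem_deg (ht : t ≤ 2) (hn : 2 ≤ n) (hd : IsDrawing G i a b) {d : ℝ} {z : tGC t G}
    (hz : z ∈ tGCdeg t G d) : hexagonMap t G i a b z ∈ tGCdeg t G (d + 1) := by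
  have := mem_tGCdeg_of_hasDegree (hasDegree_hexagonMap ht hn hd) hz
  rwa [← hexagonMap_eq] at this

/-- The pentagon map is a chain map. -/
lemma differential_comp_pentagonMap (ht : t ≤ 2) (hi : i.val + 1 < n)
    (hG : G' = G.swapColumns i (i + 1)) (hd : IsDrawing G i a b) :
    differential t G' ∘ₗ pentagonMap t G G' i a = pentagonMap t G G' i a ∘ₗ differential t G := by
  refine linearMap_ext fun x z => ?_
  rw [LinearMap.comp_apply, LinearMap.comp_apply, differential_eq, differential_eq,
    pentagonMap_eq]
  rw [toRealSeries_comp (hasDegree_pentagonMap ht hi hG hd) (hasDegree_differential ht G'),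
    toRealSeries_comp (hasDegree_differential ht G) (hasDegree_pentagonMap ht hi hG hd)]
  rw [CharTwo.add_eq_zero.1 (rectCount_pent_comm i a (by omega) x z), zero_add, add_zero]

/-- The hexagon map is a homotopy between the composite of the pentagon maps and the identity. -/
lemma hexagonMap_homotopy (ht : t ≤ 2) (hi : i.val + 1 < n)
    (hG : G' = G.swapColumns i (i + 1)) (hG' : G = G'.swapColumns i (i + 1))
    (hd : IsDrawing G i a b) (hd' : IsDrawing G' i b a) :
    differential t G ∘ₗ hexagonMap t G i a b + hexagonMap t G i a b ∘ₗ differential t G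
      = LinearMap.id - pentagonMap t G' G i b ∘ₗ pentagonMap t G G' i a := by
  rw [eq_sub_iff_add_eq]
  refine linearMap_ext fun x z => ?_
  have hn : 2 ≤ n := by omega
  simp only [LinearMap.add_apply, LinearMap.comp_apply, Pi.add_apply, map_add, LinearMap.id_apply]
  rw [differential_eq, hexagonMap_eq, pentagonMap_eq, pentagonMap_eq,
    toRealSeries_comp (hasDegree_hexagonMap ht hn hd) (hasDegree_differential ht G),
    toRealSeries_comp (hasDegree_differential ht G) (hasDegree_hexagonMap ht hn hd),
    toRealSeries_comp (hasDegree_pentagonMap ht hi hG hd) (hasDegree_pentagonMap ht hi hG' hd')]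
  rw [add_neg_cancel, neg_add_cancel, add_zero, ← add_mul, ← add_mul, ← map_add, ← map_add,
    rectCount_hex i a b hn hd.1]
  by_cases h : z = x
  · subst h
    simp [realPow_zero]
  · simp [h]

lemma isDrawing_swapColumns (hG : G' = G.swapColumns i (i + 1)) (hd : IsDrawing G i a b) :
    IsDrawing G' i b a := by
  subst hG
  refine ⟨hd.1.symm, ?_, ?_⟩
  · simpa [GridDiagram.swapColumns] using hd.2.2
  · simpa [GridDiagram.swapColumns] using hd.2.1

lemma eq_swapColumns_swapColumns (hG : G' = G.swapColumns i (i + 1)) :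
    G = G'.swapColumns i (i + 1) := by
  subst hG
  cases G
  simp [GridDiagram.swapColumns, mul_assoc, Equiv.swap_mul_self]

/-- A drawing exists: the points of intersection can be placed at the heights of the markings of
one of the two columns. -/
lemma exists_isDrawing (hc : IsColumnCommutationAt G G' i) : ∃ a b, IsDrawing G i a b := by
  obtain ⟨hi, h, -⟩ := hc
  have hX := G.ne i
  have hX' := G.ne (i + 1)
  have hne := succ_ne_self (by omega) i
  have n1 := G.X.injective.ne hne
  have n2 := G.O.injective.ne hne
  have key : ∀ {p q u v : Fin n}, p ≠ q → u ≠ v → p ≠ u → q ≠ v →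
      (Disjoint (Set.uIcc q p) (Set.uIcc v u) ∨ Set.uIcc q p ⊆ Set.uIcc v u ∨
        Set.uIcc v u ⊆ Set.uIcc q p) →
      ∃ a b, a ≠ b ∧ (CycIcc a b u ∧ CycIcc a b v) ∧ (CycIcc b a p ∧ CycIcc b a q) := by
    intro p q u v h1 h2 h3 h4 h
    have hp : p ∈ Set.uIcc q p := Set.right_mem_uIcc
    have hq : q ∈ Set.uIcc q p := Set.left_mem_uIcc
    have hu : u ∈ Set.uIcc v u := Set.right_mem_uIcc
    have hv : v ∈ Set.uIcc v u := Set.left_mem_uIcc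
    have arcs : ∀ {a b : Fin n}, a < b → ∀ c, (CycIcc a b c ↔ a ≤ c ∧ c ≤ b) ∧
        (CycIcc b a c ↔ b ≤ c ∨ c ≤ a) := by
      intro a b hab c
      simp only [cycIcc_iff, Fin.lt_def, Fin.le_def] at *
      omega
    rcases h with h | h | h
    · have a1 := Set.disjoint_left.1 h hp
      have a2 := Set.disjoint_left.1 h hq
      have a3 := Set.disjoint_right.1 h hu
      have a4 := Set.disjoint_right.1 h hv
      simp only [Set.mem_uIcc, Fin.le_def] at a1 a2 a3 a4
      rcases lt_or_gt_of_ne h2 with h5 | h5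
      · refine ⟨u, v, h5.ne, ?_⟩
        simp only [arcs h5, Fin.lt_def, Fin.le_def, Fin.ne_iff_vne] at *
        omega
      · refine ⟨v, u, h5.ne, ?_⟩
        simp only [arcs h5, Fin.lt_def, Fin.le_def, Fin.ne_iff_vne] at *
        omega
    · have a1 := h hp
      have a2 := h hq
      simp only [Set.mem_uIcc, Fin.le_def] at a1 a2
      rcases lt_or_gt_of_ne h1 with h5 | h5
      · refine ⟨q, p, h5.ne', ?_⟩
        simp only [arcs h5, Fin.lt_def, Fin.le_def, Fin.ne_iff_vne] at *
        omega
      · refine ⟨p, q, h5.ne', ?_⟩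
        simp only [arcs h5, Fin.lt_def, Fin.le_def, Fin.ne_iff_vne] at *
        omega
    · have a1 := h hu
      have a2 := h hv
      simp only [Set.mem_uIcc, Fin.le_def] at a1 a2
      rcases lt_or_gt_of_ne h2 with h5 | h5
      · refine ⟨u, v, h5.ne, ?_⟩
        simp only [arcs h5, Fin.lt_def, Fin.le_def, Fin.ne_iff_vne] at *
        omega
      · refine ⟨v, u, h5.ne, ?_⟩
        simp only [arcs h5, Fin.lt_def, Fin.le_def, Fin.ne_iff_vne] at *
        omega
  exact key hX hX' n1.symm n2.symm h

end

/-! ### Isomorphisms on homology -/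

section
variable {t : ℝ≥0} {G G' G'' : GridDiagram n}

lemma map_mem_ker {f : tGC t G →ₗ[Rt t] tGC t G'}
    (hf : differential t G' ∘ₗ f = f ∘ₗ differential t G) :
    ∀ z ∈ LinearMap.ker (differential t G), f z ∈ LinearMap.ker (differential t G') := by
  intro z hz
  rw [LinearMap.mem_ker] at *
  rw [← LinearMap.comp_apply, hf, LinearMap.comp_apply, hz, map_zero]

/-- The map on homology induced by a chain map. -/
noncomputable def homologyMap (f : tGC t G →ₗ[Rt t] tGC t G')
    (hf : differential t G' ∘ₗ f = f ∘ₗ differential t G) : tGH t G →ₗ[Rt t] tGH t G' :=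
  Submodule.mapQ _ _ (f.restrict (map_mem_ker hf)) (by
    rintro ⟨z, hz⟩ ⟨v, rfl⟩
    exact ⟨f v, LinearMap.congr_fun hf v⟩)

lemma homologyMap_class (f : tGC t G →ₗ[Rt t] tGC t G')
    (hf : differential t G' ∘ₗ f = f ∘ₗ differential t G)
    (z : LinearMap.ker (differential t G)) (z' : LinearMap.ker (differential t G'))
    (h : (z' : tGC t G') = f z) : homologyMap f hf (tGHclass t G z) = tGHclass t G' z' := by
  have : z' = f.restrict (map_mem_ker hf) z := Subtype.ext h
  rw [this]
  rfl

/-- Chain maps whose composite is homotopic to the identity induce maps on homology whose composite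
is the identity. -/
lemma homologyMap_comp_eq_id (f : tGC t G →ₗ[Rt t] tGC t G') (g : tGC t G' →ₗ[Rt t] tGC t G)
    (h : tGC t G →ₗ[Rt t] tGC t G) (hf : differential t G' ∘ₗ f = f ∘ₗ differential t G)
    (hg : differential t G ∘ₗ g = g ∘ₗ differential t G')
    (hh : differential t G ∘ₗ h + h ∘ₗ differential t G = LinearMap.id - g ∘ₗ f) :
    homologyMap g hg ∘ₗ homologyMap f hf = LinearMap.id := by
  refine LinearMap.ext fun c => ?_
  obtain ⟨z, rfl⟩ := Submodule.mkQ_surjective _ c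
  refine ((Submodule.Quotient.eq _).2 ?_).symm
  refine ⟨h z, ?_⟩
  have e := LinearMap.congr_fun hh (z : tGC t G)
  simp only [LinearMap.add_apply, LinearMap.comp_apply, LinearMap.mem_ker.1 z.2, map_zero,
    add_zero] at e
  exact e

lemma homologyMap_mem_deg (f : tGC t G →ₗ[Rt t] tGC t G')
    (hf : differential t G' ∘ₗ f = f ∘ₗ differential t G)
    (hd : ∀ d, ∀ z ∈ tGCdeg t G d, f z ∈ tGCdeg t G' d) {d : ℝ} {c : tGH t G}
    (hc : c ∈ tGHdeg t G d) : homologyMap f hf c ∈ tGHdeg t G' d := by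
  obtain ⟨z, hz, rfl⟩ := hc
  exact ⟨f.restrict (map_mem_ker hf) z, hd d _ hz, rfl⟩

/-- Homogeneous chain maps that are inverse to each other up to homotopy induce an isomorphism of
graded modules on homology. -/
lemma exists_gradedIso (f : tGC t G →ₗ[Rt t] tGC t G') (g : tGC t G' →ₗ[Rt t] tGC t G)
    (h : tGC t G →ₗ[Rt t] tGC t G) (h' : tGC t G' →ₗ[Rt t] tGC t G')
    (hf : differential t G' ∘ₗ f = f ∘ₗ differential t G)
    (hg : differential t G ∘ₗ g = g ∘ₗ differential t G')
    (hfd : ∀ d, ∀ z ∈ tGCdeg t G d, f z ∈ tGCdeg t G' d)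
    (hgd : ∀ d, ∀ z ∈ tGCdeg t G' d, g z ∈ tGCdeg t G d)
    (hh : differential t G ∘ₗ h + h ∘ₗ differential t G = LinearMap.id - g ∘ₗ f)
    (hh' : differential t G' ∘ₗ h' + h' ∘ₗ differential t G' = LinearMap.id - f ∘ₗ g) :
    ∃ e : GradedIso t G G',
      (∀ (z : LinearMap.ker (differential t G)) (z' : LinearMap.ker (differential t G')),
        (z' : tGC t G') = f z → e.toEquiv (tGHclass t G z) = tGHclass t G' z') ∧
      (∀ (z' : LinearMap.ker (differential t G')) (z : LinearMap.ker (differential t G)),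
        (z : tGC t G) = g z' → e.toEquiv.symm (tGHclass t G' z') = tGHclass t G z) := by
  have h1 := homologyMap_comp_eq_id f g h hf hg hh
  have h2 := homologyMap_comp_eq_id g f h' hg hf hh'
  refine ⟨⟨LinearEquiv.ofLinearMap (homologyMap f hf) (homologyMap g hg) h2 h1, fun d c =>
    ⟨homologyMap_mem_deg f hf hfd, fun hc => ?_⟩⟩, homologyMap_class f hf, homologyMap_class g hg⟩
  have := homologyMap_mem_deg g hg hgd hc
  rwa [LinearEquiv.coe_ofLinearMap, ← LinearMap.comp_apply, h1] at this

/-- The inverse of an isomorphism of graded modules. -/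
noncomputable def GradedIso.symm (e : GradedIso t G G') : GradedIso t G' G where
  toEquiv := e.toEquiv.symm
  map_deg d z := by rw [e.map_deg, LinearEquiv.apply_symm_apply]

/-- The composite of two isomorphisms of graded modules. -/
noncomputable def GradedIso.trans (e : GradedIso t G G') (e' : GradedIso t G' G'') :
    GradedIso t G G'' where
  toEquiv := e.toEquiv.trans e'.toEquiv
  map_deg d z := by rw [e.map_deg, e'.map_deg]; rfl

/-- The linear map between two complexes that is given by a map of grid states. -/
noncomputable def stateMap (t : ℝ≥0) (φ : GridState n → GridState n) :
    (GridState n → Rt t) →ₗ[Rt t] (GridState n → Rt t) :=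
  Fintype.linearCombination (Rt t) fun x => Pi.single (φ x) 1

lemma stateMap_single (φ : GridState n → GridState n) (x : GridState n) (c : Rt t) :
    stateMap t φ (Pi.single x c) = Pi.single (φ x) c := by
  rw [stateMap, Fintype.linearCombination_apply_single, ← Pi.single_smul, smul_eq_mul, mul_one]

lemma stateMap_comp_symm (φ : GridState n ≃ GridState n) :
    stateMap t φ.symm ∘ₗ stateMap t φ = LinearMap.id := by
  refine LinearMap.pi_ext' fun x => LinearMap.ext_ring ?_
  simp [stateMap_single]

lemma stateMap_mem_deg {φ : GridState n → GridState n}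
    (hgr : ∀ x, gr t G' 0 (φ x) = gr t G 0 x) {d : ℝ} {z : tGC t G} (hz : z ∈ tGCdeg t G d) :
    (stateMap t φ z : tGC t G') ∈ tGCdeg t G' d := by
  induction hz using AddSubgroup.closure_induction with
  | zero => rw [map_zero]; exact zero_mem _
  | add a b _ _ ha hb => rw [map_add]; exact add_mem ha hb
  | neg a _ ha => rw [map_neg]; exact neg_mem ha
  | mem m hm =>
    obtain ⟨x, α, hα, hd, rfl⟩ := hm
    rw [stateMap_single]
    refine AddSubgroup.subset_closure ⟨φ x, α, hα, ?_, rfl⟩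
    have := hgr x
    simp only [gr, NNReal.coe_zero] at *
    linarith

lemma stateMap_chain (ht : t ≤ 2) (φ : GridState n ≃ GridState n)
    (hgr : ∀ x, gr t G' 0 (φ x) = gr t G 0 x)
    (hc : ∀ x y, rectCount IsEmptyRegion (φ x) (φ y) = rectCount IsEmptyRegion x y) :
    differential t G' ∘ₗ stateMap t φ = stateMap t φ ∘ₗ differential t G := by
  refine linearMap_ext fun x z => ?_
  obtain ⟨y, rfl⟩ := φ.surjective z
  have e : ∀ v : GridState n → Rt t, stateMap t φ v (φ y) = v y := by
    intro v
    rw [stateMap, Fintype.linearCombination_apply]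
    simp [Finset.sum_apply, Pi.single_apply]
  rw [LinearMap.comp_apply, LinearMap.comp_apply, stateMap_single, e, differential_eq,
    differential_eq, regionMap_single, regionMap_single, one_mul, one_mul,
    toRealSeries_regionCoeff (hasDegree_differential ht G'),
    toRealSeries_regionCoeff (hasDegree_differential ht G), hc, hgr, hgr]

/-- A bijection between the states of two diagrams that preserves the gradings and the numbers of
empty rectangles induces an isomorphism on homology. -/
lemma nonempty_gradedIso_of_equiv (ht : t ≤ 2) (φ : GridState n ≃ GridState n)
    (hgr : ∀ x, gr t G' 0 (φ x) = gr t G 0 x)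
    (hc : ∀ x y, rectCount IsEmptyRegion (φ x) (φ y) = rectCount IsEmptyRegion x y) :
    Nonempty (GradedIso t G G') := by
  have hgr' : ∀ x, gr t G 0 (φ.symm x) = gr t G' 0 x := fun x => by
    rw [← hgr, φ.apply_symm_apply]
  have hc' : ∀ x y, rectCount IsEmptyRegion (φ.symm x) (φ.symm y) = rectCount IsEmptyRegion x y :=
    fun x y => by rw [← hc, φ.apply_symm_apply, φ.apply_symm_apply]
  have h1 := stateMap_comp_symm (t := t) φ
  have h2 := stateMap_comp_symm (t := t) φ.symm
  rw [φ.symm_symm] at h2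
  obtain ⟨e, -⟩ := exists_gradedIso (G := G) (G' := G') (stateMap t φ) (stateMap t φ.symm) 0 0
    (stateMap_chain ht φ hgr hc) (stateMap_chain ht φ.symm hgr' hc')
    (fun d z => stateMap_mem_deg hgr) (fun d z => stateMap_mem_deg hgr')
    (by rw [h1, sub_self, LinearMap.comp_zero, LinearMap.zero_comp, add_zero])
    (by rw [h2, sub_self, LinearMap.comp_zero, LinearMap.zero_comp, add_zero])
  exact ⟨e⟩

lemma gr_congr {x y : GridState n} (hO : maslovInt G'.O y = maslovInt G.O x)
    (hX : maslovInt G'.X y = maslovInt G.X x) : gr t G' 0 y = gr t G 0 x := by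
  simp only [gr, maslov, alexander, maslovOf_eq_maslovInt, hO, hX]

/-! ### Rotations and the reflection in the diagonal -/

/-- A map of states that is given on the vertical circles and on rectangles preserves the number
of empty rectangles. -/
lemma rectCount_congr (φ : GridState n ≃ GridState n) {x : GridState n}
    (ψ : Fin n × Fin n ≃ Fin n × Fin n) (h : ∀ p, (ψ p).1 ≠ (ψ p).2 ↔ p.1 ≠ p.2)
    (hs : ∀ p, φ (x * Equiv.swap p.1 p.2) = φ x * Equiv.swap (ψ p).1 (ψ p).2)
    (hE : ∀ p, IsEmptyRegion (φ x) (ψ p) ↔ IsEmptyRegion x p) (y : GridState n) :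
    rectCount IsEmptyRegion (φ x) (φ y) = rectCount IsEmptyRegion x y := by
  classical
  rw [rectCount, rectCount]
  congr 1
  refine (Finset.card_equiv ψ fun p => ?_).symm
  simp only [Finset.mem_filter, mem_rect, h, hE, ← hs, φ.injective.eq_iff]

/-- Reflection of the states in the diagonal. -/
def transposeState : GridState n ≃ GridState n := Equiv.inv (GridState n)

lemma transposeState_apply_apply (x : GridState n) (c : Fin n) : transposeState x (x c) = c :=
  x.symm_apply_apply c

lemma transposeState_mul_swap (x : GridState n) (l r : Fin n) :
    transposeState (x * Equiv.swap l r) = transposeState x * Equiv.swap (x l) (x r) := by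
  show (x * Equiv.swap l r)⁻¹ = x⁻¹ * Equiv.swap (x l) (x r)
  rw [mul_inv_rev, Equiv.swap_inv, Equiv.swap_apply_apply]
  group

lemma maslovInt_transpose (S : Equiv.Perm (Fin n)) (x : GridState n) :
    maslovInt (transposeState S) (transposeState x) = maslovInt S x := by
  classical
  refine maslovInt_congr transposeState rfl (fun x l r h => ?_) x
  rw [transposeState_mul_swap, maslovFormula _ _ (x.injective.ne h), maslovFormula _ _ h]
  have e1 : (markCount (transposeState S) (inRect (transposeState x) (x l, x r)) : ℤ) =
      markCount S (inRect x (l, r)) := by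
    rw [markCount_eq_sum, markCount_eq_sum, ← Equiv.sum_comp S]
    refine Finset.sum_congr rfl fun d _ => if_congr ?_ rfl rfl
    simp [inRect, transposeState_apply_apply, and_comm]
  have e2 : interiorCount (transposeState x) (x l) (x r) = interiorCount x l r := by
    rw [interiorCount, interiorCount, ← Equiv.sum_comp x]
    refine Finset.sum_congr rfl fun d _ => if_congr ?_ rfl rfl
    simp [transposeState_apply_apply, and_comm]
  rw [e1, e2]

lemma nonempty_gradedIso_transpose (ht : t ≤ 2) (G : GridDiagram n) :
    Nonempty (GradedIso t G G.transpose) := by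
  refine nonempty_gradedIso_of_equiv ht transposeState
    (fun x => gr_congr (maslovInt_transpose G.O x) (maslovInt_transpose G.X x)) fun x y => ?_
  refine rectCount_congr _ (x.prodCongr x) ?_ ?_ ?_ y
  · intro p; simp
  · intro p; exact transposeState_mul_swap x _ _
  · intro p
    unfold IsEmptyRegion
    rw [← x.forall_congr_right]
    simp only [Equiv.prodCongr_apply, Prod.map_fst, Prod.map_snd, transposeState_apply_apply]
    exact forall_congr' fun c => by tauto

variable [NeZero n]

/-- Rotation of the states. -/
def rotateState (p q : Fin n) : GridState n ≃ GridState n :=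
  (Equiv.mulLeft (Equiv.addRight q)).trans (Equiv.mulRight (Equiv.addRight p))

lemma rotateState_apply (p q : Fin n) (x : GridState n) (c : Fin n) :
    rotateState p q x c = x (c + p) + q := rfl

lemma cycIco_add (s t r q : Fin n) : CycIco (s + q) (t + q) (r + q) ↔ CycIco s t r := by
  simp [CycIco]

lemma cycIoo_add (s t r q : Fin n) : CycIoo (s + q) (t + q) (r + q) ↔ CycIoo s t r := by
  simp [cycIoo_iff, cycIco_add]

lemma cycIco_sub (s t r q : Fin n) : CycIco (s - q) (t - q) (r - q) ↔ CycIco s t r := by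
  simp [CycIco]

lemma cycIoo_sub (s t r q : Fin n) : CycIoo (s - q) (t - q) (r - q) ↔ CycIoo s t r := by
  simp [cycIoo_iff, cycIco_sub]

lemma rotateState_mul_swap (p q : Fin n) (x : GridState n) (l r : Fin n) :
    rotateState p q (x * Equiv.swap l r) = rotateState p q x * Equiv.swap (l - p) (r - p) := by
  ext c : 1
  rw [Equiv.Perm.mul_apply, rotateState_apply, rotateState_apply, Equiv.Perm.mul_apply]
  simp only [Equiv.swap_apply_def, eq_sub_iff_add_eq]
  split_ifs <;> simp

lemma maslovInt_rotate (p q : Fin n) (S : Equiv.Perm (Fin n)) (x : GridState n) :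
    maslovInt (rotateState p q S) (rotateState p q x) = maslovInt S x := by
  classical
  refine maslovInt_congr (rotateState p q) rfl (fun x l r h => ?_) x
  have h' : l - p ≠ r - p := fun e => h (sub_left_injective e)
  rw [rotateState_mul_swap, maslovFormula _ _ h', maslovFormula _ _ h]
  have e1 : (markCount (rotateState p q S) (inRect (rotateState p q x) (l - p, r - p)) : ℤ) =
      markCount S (inRect x (l, r)) := by
    rw [markCount_eq_sum, markCount_eq_sum, ← Equiv.sum_comp (Equiv.subRight p)]
    refine Finset.sum_congr rfl fun d _ => ?_
    refine if_congr ?_ rfl rfl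
    simp [inRect, rotateState_apply, cycIco_add, cycIco_sub]
  have e2 : interiorCount (rotateState p q x) (l - p) (r - p) = interiorCount x l r := by
    rw [interiorCount, interiorCount, ← Equiv.sum_comp (Equiv.subRight p)]
    refine Finset.sum_congr rfl fun d _ => ?_
    simp [rotateState_apply, cycIoo_add, cycIoo_sub]
  rw [e1, e2]

lemma nonempty_gradedIso_rotate (ht : t ≤ 2) (G : GridDiagram n) (p q : Fin n) :
    Nonempty (GradedIso t G (G.rotate p q)) := by
  refine nonempty_gradedIso_of_equiv ht (rotateState p q)
    (fun x => gr_congr (maslovInt_rotate p q G.O x) (maslovInt_rotate p q G.X x)) fun x y => ?_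
  refine rectCount_congr _ ((Equiv.subRight p).prodCongr (Equiv.subRight p)) ?_ ?_ ?_ y
  · intro p'; simp
  · intro p'; exact rotateState_mul_swap p q x _ _
  · intro p'
    unfold IsEmptyRegion
    rw [← (Equiv.subRight p).forall_congr_right]
    simp [rotateState_apply, cycIoo_add, cycIoo_sub]

end

/-! ### Commutation moves -/

variable [NeZero n]

/-- A planar column commutation induces an isomorphism of graded modules. -/
lemma columnCommutation {t : ℝ≥0} (ht : t ≤ 2) {G G' : GridDiagram n} {i : Fin n}
    (hc : IsColumnCommutationAt G G' i) {a b : Fin n} (hd : IsDrawing G i a b) :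
    ∃ e : GradedIso t G G',
      (∀ (z : LinearMap.ker (differential t G)) (z' : LinearMap.ker (differential t G')),
        (z' : tGC t G') = pentagonMap t G G' i a z →
          e.toEquiv (tGHclass t G z) = tGHclass t G' z') ∧
      (∀ (z' : LinearMap.ker (differential t G')) (z : LinearMap.ker (differential t G)),
        (z : tGC t G) = pentagonMap t G' G i b z' →
          e.toEquiv.symm (tGHclass t G' z') = tGHclass t G z) := by
  have hG := hc.2.2
  have hG' := eq_swapColumns_swapColumns hG
  have hd' := isDrawing_swapColumns hG hd
  exact exists_gradedIso _ _ (hexagonMap t G i a b) (hexagonMap t G' i b a)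
    (differential_comp_pentagonMap ht hc.1 hG hd) (differential_comp_pentagonMap ht hc.1 hG' hd')
    (fun d z hz => pentagonMap_mem_deg ht hc.1 hG hd hz)
    (fun d z hz => pentagonMap_mem_deg ht hc.1 hG' hd' hz)
    (hexagonMap_homotopy ht hc.1 hG hG' hd hd') (hexagonMap_homotopy ht hc.1 hG' hG hd' hd)

lemma nonempty_gradedIso_of_planar {t : ℝ≥0} (ht : t ≤ 2) {G G' : GridDiagram n}
    (h : IsPlanarCommutation G G') : Nonempty (GradedIso t G G') := by
  have key : ∀ {G G' : GridDiagram n} {i : Fin n}, IsColumnCommutationAt G G' i →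
      Nonempty (GradedIso t G G') := by
    intro G G' i hc
    obtain ⟨a, b, hd⟩ := exists_isDrawing hc
    obtain ⟨e, -⟩ := columnCommutation ht hc hd
    exact ⟨e⟩
  rcases h with ⟨i, hc⟩ | ⟨i, hc⟩
  · exact key hc
  · obtain ⟨e⟩ := key hc
    obtain ⟨e1⟩ := nonempty_gradedIso_transpose ht G
    obtain ⟨e2⟩ := nonempty_gradedIso_transpose ht G'
    exact ⟨(e1.trans e).trans e2.symm⟩

lemma nonempty_gradedIso_of_commutation {t : ℝ≥0} (ht : t ≤ 2) {G G' : GridDiagram n}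
    (h : DifferByCommutation G G') : Nonempty (GradedIso t G G') := by
  obtain ⟨p, q, p', q', h⟩ := h
  obtain ⟨e⟩ := nonempty_gradedIso_of_planar ht h
  obtain ⟨e1⟩ := nonempty_gradedIso_rotate ht G p q
  obtain ⟨e2⟩ := nonempty_gradedIso_rotate ht G' p' q'
  exact ⟨(e1.trans e).trans e2.symm⟩

end GridHomology

open GridHomology
theorem mainTheorem6 {n : ℕ} [NeZero n] (t : ℝ≥0) (ht : t ≤ 2) :
    -- Invariance under commutation moves.
    (∀ G G' : GridDiagram n, DifferByCommutation G G' → Nonempty (GradedIso t G G')) ∧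
    -- For a column commutation there is a drawing of both diagrams on one torus, and for every
    -- such drawing the isomorphism is induced by the pentagon maps.
    (∀ (G G' : GridDiagram n) (i : Fin n), IsColumnCommutationAt G G' i →
      (∃ a b, IsDrawing G i a b) ∧
      ∀ a b, IsDrawing G i a b →
        -- The pentagon maps are chain maps and preserve the grading.
        differential t G' ∘ₗ pentagonMap t G G' i a
          = pentagonMap t G G' i a ∘ₗ differential t G ∧
        differential t G ∘ₗ pentagonMap t G' G i b
          = pentagonMap t G' G i b ∘ₗ differential t G' ∧
        (∀ d, ∀ z ∈ tGCdeg t G d, pentagonMap t G G' i a z ∈ tGCdeg t G' d) ∧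
        (∀ d, ∀ z ∈ tGCdeg t G' d, pentagonMap t G' G i b z ∈ tGCdeg t G d) ∧
        -- The hexagon maps have degree one and are homotopies from the composites of the
        -- pentagon maps to the identities.
        (∀ d, ∀ z ∈ tGCdeg t G d, hexagonMap t G i a b z ∈ tGCdeg t G (d + 1)) ∧
        (∀ d, ∀ z ∈ tGCdeg t G' d, hexagonMap t G' i b a z ∈ tGCdeg t G' (d + 1)) ∧
        differential t G ∘ₗ hexagonMap t G i a b + hexagonMap t G i a b ∘ₗ differential t G
          = LinearMap.id - pentagonMap t G' G i b ∘ₗ pentagonMap t G G' i a ∧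
        differential t G' ∘ₗ hexagonMap t G' i b a + hexagonMap t G' i b a ∘ₗ differential t G'
          = LinearMap.id - pentagonMap t G G' i a ∘ₗ pentagonMap t G' G i b ∧
        -- The pentagon maps induce mutually inverse isomorphisms of graded modules.
        ∃ e : GradedIso t G G',
          (∀ (z : LinearMap.ker (differential t G)) (z' : LinearMap.ker (differential t G')),
            (z' : tGC t G') = pentagonMap t G G' i a z →
              e.toEquiv (tGHclass t G z) = tGHclass t G' z') ∧
          (∀ (z' : LinearMap.ker (differential t G')) (z : LinearMap.ker (differential t G)),
            (z : tGC t G) = pentagonMap t G' G i b z' →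
              e.toEquiv.symm (tGHclass t G' z') = tGHclass t G z)) := by
  refine ⟨fun G G' h => nonempty_gradedIso_of_commutation ht h, fun G G' i hc =>
    ⟨exists_isDrawing hc, fun a b hd => ?_⟩⟩
  have hG := hc.2.2
  have hG' := eq_swapColumns_swapColumns hG
  have hd' := isDrawing_swapColumns hG hd
  have hn : 2 ≤ n := by have := hc.1; omega
  exact ⟨differential_comp_pentagonMap ht hc.1 hG hd,
    differential_comp_pentagonMap ht hc.1 hG' hd',
    fun d z hz => pentagonMap_mem_deg ht hc.1 hG hd hz,
    fun d z hz => pentagonMap_mem_deg ht hc.1 hG' hd' hz,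
    fun d z hz => hexagonMap_mem_deg ht hn hd hz,
    fun d z hz => hexagonMap_mem_deg ht hn hd' hz,
    hexagonMap_homotopy ht hc.1 hG hG' hd hd', hexagonMap_homotopy ht hc.1 hG' hG hd' hd,
    columnCommutation ht hc hd⟩
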